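/- For a group $\Gamma$, the Jordan constant $\mathrm{J}(\Gamma)$ is the least positive integer $m$ such that every finite subgroup $G\subset\Gamma$ contains a normal abelian subgroup of index at most $m$, and the weak Jordan constant $\overline{\mathrm{J}}(\Gamma)$ is the least positive integer $m$ such that every finite subgroup $G\subset\Gamma$ contains a (not necessarily normal) abelian subgroup of index at most $m$; each is $\infty$ if no such $m$ exists. Let $X$ be a smooth projective surface over $\mathbb{R}$ (an integral scheme, smooth of relative dimension $2$ and proper over $\mathbb{R}$) that is $\mathbb{R}$-rational, that is, birational over $\mathbb{R}$ to affine space. Let $\pi\colon X\to\mathbb{P}^1_{\mathbb{R}}$ be a conic bundle structure: a morphism over $\mathbb{R}$ whose scheme-theoretic fibre over every point $b\in\mathbb{P}^1_{\mathbb{R}}$ is isomorphic, over the residue field $\kappa(b)$, to a reduced conic in $\mathbb{P}^2_{\kappa(b)}$. Let $\mathrm{Aut}(X,\pi)$ be the group of those automorphisms $g$ of $X$ over $\mathbb{R}$ that preserve $\pi$, i.e. for which there is an automorphism $\beta$ of $\mathbb{P}^1_{\mathbb{R}}$ over $\mathbb{R}$ with $\pi\circ g=\beta\circ\pi$. Then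 \[ \mathrm{J}(\mathrm{Aut}(X,\pi))\leqslant 32,\qquad \overline{\mathrm{J}}(\mathrm{Aut}(X,\pi))\leqslant 8 . \] -/

import Mathlib

open CategoryTheory AlgebraicGeometry

noncomputable section

namespace ConicBundles

universe u

/-! ### Jordan constants of groups -/

/-- Every finite subgroup `G` of `Γ` contains a normal abelian subgroup of index at most `m`. -/
def IsJordanBound (Γ : Type u) [Group Γ] (m : ℕ) : Prop :=
  ∀ G : Subgroup Γ, Finite G →
    ∃ A : Subgroup G, A.Normal ∧ IsMulCommutative A ∧ A.index ≤ m

/-- Every finite subgroup `G` of `Γ` contains a (not necessarily normal) abelian subgroup of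
index at most `m`. -/
def IsWeakJordanBound (Γ : Type u) [Group Γ] (m : ℕ) : Prop :=
  ∀ G : Subgroup Γ, Finite G →
    ∃ A : Subgroup G, IsMulCommutative A ∧ A.index ≤ m

/-- The Jordan constant of `Γ`: the least positive integer that is a Jordan bound, and `⊤` if
there is none (that is, if `Γ` is not a Jordan group). -/
def jordanConstant (Γ : Type u) [Group Γ] : ℕ∞ :=
  ⨅ m ∈ {m : ℕ | 0 < m ∧ IsJordanBound Γ m}, (m : ℕ∞)

/-- The weak Jordan constant of `Γ`, with value `⊤` if there is no bound. -/
def weakJordanConstant (Γ : Type u) [Group Γ] : ℕ∞ :=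
  ⨅ m ∈ {m : ℕ | 0 < m ∧ IsWeakJordanBound Γ m}, (m : ℕ∞)

/-! ### Projective space and conics over a field -/

/-- The standard grading of `K[x₀, …, xₙ]`. -/
abbrev grading (n : ℕ) (K : Type u) [Field K] :
    ℕ → Submodule K (MvPolynomial (Fin (n + 1)) K) :=
  MvPolynomial.homogeneousSubmodule (Fin (n + 1)) K

instance gradingGradedAlgebra (n : ℕ) (K : Type u) [Field K] : GradedAlgebra (grading n K) :=
  MvPolynomial.gradedAlgebra

/-- Projective space `ℙⁿ_K = Proj K[x₀, …, xₙ]`, as a scheme over `Spec K`. -/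
def projectiveSpace (n : ℕ) (K : Type u) [Field K] : Over (Spec (.of K)) :=
  Over.mk (Y := Proj (grading n K))
    (Proj.toSpecZero (grading n K) ≫
      Spec.map (CommRingCat.ofHom (algebraMap K (grading n K 0))))

/-- The standard affine chart `{x_j ≠ 0}` of `ℙⁿ_K`, as an affine open subset. -/
def chart (n : ℕ) (K : Type u) [Field K] (j : Fin (n + 1)) : (Proj (grading n K)).affineOpens :=
  ⟨Proj.basicOpen (grading n K) (MvPolynomial.X j),
    Proj.isAffineOpen_basicOpen (grading n K) (MvPolynomial.X j)
      (MvPolynomial.isHomogeneous_X K j) one_pos⟩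

/-- The dehomogenization `q / x_jᵈ` of a form `q` of degree `d`, as a function on the chart
`{x_j ≠ 0}`. -/
def dehomogenize {n : ℕ} {K : Type u} [Field K] {d : ℕ} {q : MvPolynomial (Fin (n + 1)) K}
    (hq : q ∈ grading n K d) (j : Fin (n + 1)) :
    Γ(Proj (grading n K), (chart n K j).1) :=
  Proj.awayToSection (grading n K) (MvPolynomial.X j)
    (HomogeneousLocalization.Away.mk (grading n K) (MvPolynomial.isHomogeneous_X K j) d q
      (by simpa using hq))

/-- A `K`-scheme `F` is a reduced conic if it is reduced and isomorphic over `K` to the closed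
subscheme `{q = 0}` of `ℙ²_K` for a nonzero quadratic form `q`: there is a closed immersion of
`F` into `ℙ²_K` whose ideal is generated by `q / x_j²` on each chart `{x_j ≠ 0}`. -/
def IsReducedConic {K : Type u} [Field K] (F : Over (Spec (.of K))) : Prop :=
  IsReduced F.left ∧
    ∃ (q : MvPolynomial (Fin 3) K) (hq : q ∈ grading 2 K 2) (i : F ⟶ projectiveSpace 2 K),
      q ≠ 0 ∧ IsClosedImmersion i.left ∧
        ∀ j : Fin 3, i.left.ker.ideal (chart 2 K j) = Ideal.span {dehomogenize hq j}

/-! ### Conic bundles -/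

/-- A morphism `π : X ⟶ B` is a conic bundle if the scheme-theoretic fibre over each point `b`
of `B` is isomorphic to a reduced conic in the projective plane over the residue field of `b`. -/
def IsConicBundle {X B : Scheme.{u}} (π : X ⟶ B) : Prop :=
  ∀ b : B, IsReducedConic (K := B.residueField b) (Over.mk (π.fiberToSpecResidueField b))

/-- For a morphism `π : X ⟶ B` in a category (such as schemes over a field), the group
`Aut(X, π)` of automorphisms of `X` that preserve `π`, that is, that lie above some
automorphism of `B`. -/
def autOver {C : Type*} [Category C] {X B : C} (π : X ⟶ B) : Subgroup (Aut X) where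
  carrier := {g | ∃ β : Aut B, g.hom ≫ π = π ≫ β.hom}
  one_mem' := ⟨1, (Category.id_comp π).trans (Category.comp_id π).symm⟩
  mul_mem' := by
    rintro g h ⟨β, hβ⟩ ⟨γ, hγ⟩
    refine ⟨β * γ, ?_⟩
    change (h.hom ≫ g.hom) ≫ π = π ≫ γ.hom ≫ β.hom
    rw [Category.assoc, hβ, reassoc_of% hγ]
  inv_mem' := by
    rintro g ⟨β, hβ⟩
    refine ⟨β⁻¹, ?_⟩
    change g.inv ≫ π = π ≫ β.inv
    exact (Iso.inv_comp_eq (α := (g : X ≅ X))).2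
      (((Iso.comp_inv_eq (α := (β : B ≅ B))).2 hβ).symm.trans (Category.assoc _ _ _))

end ConicBundles

end

/-!
A finite group `G` of automorphisms of a real rational conic bundle `π : X ⟶ ℙ¹` has a normal
abelian subgroup of index at most `8`, which gives both bounds at once.

Everything takes place at the generic point `ξ` of `X`. Let `L` be its residue field, the function
field of `X`, and let `K` be the residue field of `π ξ`, which is generated over `ℝ` by one element
(`exists_adjoin_simple_eq_top_residueField`). The group `G` acts faithfully on `L` over `ℝ` and
preserves `K` (`exists_action_residueField`, `eq_one_of_fromSpecResidueField_comp`,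
`exists_algebraMap_eq_of_comp`). Because the fibre of `π` is a conic, `L` is generated over `K` by
the coordinates of a zero of a quadratic form (`IsConicBundle.exists_coord`), and because `X` is
rational, `L` embeds in a field `ℝ(xᵢ : i ∈ n)` (`exists_algHom_fractionRing`). No other geometry
is needed.

Diagonalization of the quadratic form shows that `L` is the function field of a smooth conic
`x² - a y² = b` over `K`, or a simple extension of the algebraic closure `F` of `K` in `L`
(`isConicField_or`). In the second case `F` embeds in `ℝ(T)` by restriction to a general line, so
that `F = ℝ(τ)` by Lüroth's theorem (`exists_adjoin_simple_eq_top`), and `F` takes the place of `K`: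
either `L = F`, or `L` is the function field of the conic `x² - y² = 1` over `F`.

The field `L` embeds in an ordered field `R` in which all non-negative elements are squares, an
ultrapower of `ℝ` (`exists_orderedField_fractionRing`). One of `a` and `b` is non-negative in `R`,
so that the conic becomes rational over `R`. Hence the kernel of `G → Aut K` acts faithfully on
`R(X)` by Möbius transformations. It preserves a positive definite binary form up to scalars, and
is therefore cyclic or dihedral (`IsProjRep.exists_isCyclic`, `exists_isCyclic_of_ratFunc`).
Likewise, the image of `G` in the automorphism group of `K` has a cyclic subgroup of index at most
two.

Such an extension of a dihedral group by a dihedral group could still act on the rotations in the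
kernel through many automorphisms. What prevents this is a rationality property: a Möbius
transformation of finite order has the invariant `tr² / det = ζ + ζ⁻¹ + 2` with a root of unity
`ζ`, and this is a real number, so it is fixed by the action of `G` on the algebraic closure of `K`.
Consequently conjugation by `G` raises no element of the kernel to a power other than `±1`
(`pow_eq_one_or_of_conj`, `conj_eq_or_eq_inv`). From here the bound is pure group theory
(`exists_normal_abelian_index_le_eight`): if the kernel contains a rotation `c` of order at least
three, then the elements that commute with `c` and map into the cyclic subgroup of `Aut K` form a
normal abelian subgroup of index at most four; otherwise the kernel has exponent two and order at
most four, and its centralizer takes the place of that of `c`.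
-/

namespace ConicBundles

/-! ### Normal abelian subgroups of extensions of dihedral groups -/

section GroupTheory

variable {G : Type*} [Group G]

lemma index_le_two_of_mul_mem {S : Subgroup G}
    (h : ∀ a b, a ∉ S → b ∉ S → a * b ∈ S) : S.index ≤ 2 := by
  by_cases hS : S = ⊤
  · simp [hS]
  · obtain ⟨a, ha⟩ : ∃ a, a ∉ S := by
      by_contra! hall
      exact hS (Subgroup.eq_top_iff' S |>.2 hall)
    refine (Subgroup.index_eq_two_iff.2 ⟨a, fun b ↦ ?_⟩).le
    by_cases hb : b ∈ S
    · exact Or.inr ⟨hb, fun hba ↦ ha (by simpa using S.mul_mem (S.inv_mem hb) hba)⟩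
    · exact Or.inl ⟨h b a hb ha, hb⟩

lemma normal_of_index_le_two [Finite G] {S : Subgroup G} (h : S.index ≤ 2) : S.Normal := by
  have h0 : S.index ≠ 0 := Subgroup.index_ne_zero_of_finite
  obtain h1 | h2 : S.index = 1 ∨ S.index = 2 := by omega
  · rw [Subgroup.index_eq_one] at h1
    rw [h1]
    infer_instance
  · exact Subgroup.normal_of_index_eq_two h2

/-- A subgroup whose image under `f` is cyclic and whose intersection with the kernel of `f` is
central is abelian. -/
lemma isMulCommutative_of_map_le_isCyclic {H : Type*} [Group H] (f : G →* H) (Z : Subgroup H)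
    [IsCyclic Z] (S : Subgroup G) (hS : S ≤ Z.comap f)
    (hcomm : ∀ n ∈ f.ker, n ∈ S → ∀ s ∈ S, s * n = n * s) : IsMulCommutative S := by
  let φ : S →* Z := (f.comp S.subtype).codRestrict Z fun s ↦ hS s.2
  refine φ.isMulCommutative_of_isCyclic_of_ker_le_center fun n hn ↦ ?_
  rw [Subgroup.mem_center_iff]
  intro s
  have hn' : f n = 1 := congrArg Subtype.val (MonoidHom.mem_ker.1 hn)
  exact Subtype.ext (hcomm n hn' n.2 s s.2)

set_option maxRecDepth 100000 in
lemma orderOf_perm_le_four {α : Type*} [Finite α] (hα : Nat.card α ≤ 4) (σ : Equiv.Perm α) :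
    orderOf σ ≤ 4 := by
  have key : ∀ τ : Equiv.Perm (Fin 4), τ ^ 3 = 1 ∨ τ ^ 4 = 1 := by decide
  classical
  have := Fintype.ofFinite α
  have e : α ↪ Fin 4 := by
    refine (Function.Embedding.nonempty_of_card_le ?_).some
    simpa [Nat.card_eq_fintype_card] using hα
  have inj : Function.Injective (Equiv.Perm.viaEmbeddingHom e) :=
    Equiv.Perm.viaEmbeddingHom_injective e
  rw [← orderOf_injective _ inj]
  rcases key (Equiv.Perm.viaEmbeddingHom e σ) with h | h
  · exact (orderOf_le_of_pow_eq_one (by norm_num) h).trans (by norm_num)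
  · exact orderOf_le_of_pow_eq_one (by norm_num) h

/-- The case of a kernel with a rotation of order at least three. Every element of `G` maps the
generator `c` of the rotation subgroup to `c` or `c⁻¹`, and the centralizer of `c` meets the kernel
only in rotations. -/
lemma exists_normal_abelian_of_sq_ne_one [Finite G] {H : Type*} [Group H] (f : G →* H)
    (Z : Subgroup H) [IsCyclic Z] (hZ : (Z.comap f).index ≤ 2)
    (c : G) (hc : c ∈ f.ker) (hcc : c * c ≠ 1)
    (hsq : ∀ n ∈ f.ker, n ∉ Subgroup.zpowers c → n * n = 1)
    (hconj : ∀ s ∈ f.ker, ∀ g : G, g * s * g⁻¹ ∈ Subgroup.zpowers s →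
      g * s * g⁻¹ = s ∨ g * s * g⁻¹ = s⁻¹) :
    ∃ A : Subgroup G, A.Normal ∧ IsMulCommutative A ∧ A.index ≤ 8 := by
  have hg : ∀ g : G, g * c * g⁻¹ = c ∨ g * c * g⁻¹ = c⁻¹ := by
    refine fun g ↦ hconj c hc g ?_
    by_contra hmem
    have h1 := hsq _ ((f.normal_ker).conj_mem c hc g) hmem
    apply hcc
    have h2 : g * (c * c) * g⁻¹ = 1 := by rw [← h1]; group
    simpa using h2
  have hWi : (Subgroup.centralizer {c}).index ≤ 2 := by
    refine index_le_two_of_mul_mem fun a b ha hb ↦ ?_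
    rw [Subgroup.mem_centralizer_singleton_iff] at ha hb ⊢
    have ha' : a * c * a⁻¹ = c⁻¹ := (hg a).resolve_left fun h ↦ ha (by
      rw [mul_inv_eq_iff_eq_mul] at h; exact h)
    have hb' : b * c * b⁻¹ = c⁻¹ := (hg b).resolve_left fun h ↦ hb (by
      rw [mul_inv_eq_iff_eq_mul] at h; exact h)
    rw [mul_inv_eq_iff_eq_mul] at hb'
    have ha2 : a * c⁻¹ * a⁻¹ = c := by
      have := congrArg (·⁻¹) ha'
      simpa [mul_assoc] using this
    rw [mul_inv_eq_iff_eq_mul] at ha2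
    rw [mul_assoc, hb', ← mul_assoc, ha2, mul_assoc]
  have hPn := normal_of_index_le_two hZ
  have hWn := normal_of_index_le_two hWi
  refine ⟨Z.comap f ⊓ Subgroup.centralizer {c}, inferInstance, ?_, ?_⟩
  · refine isMulCommutative_of_map_le_isCyclic f Z _ inf_le_left fun n hn hnW s hs ↦ ?_
    have hnc := Subgroup.mem_centralizer_singleton_iff.1 hnW.2
    have hsc := Subgroup.mem_centralizer_singleton_iff.1 hs.2
    have hnC : n ∈ Subgroup.zpowers c := by
      by_contra hnC
      have h1 := hsq n hn hnC
      have h2 : n * c ∉ Subgroup.zpowers c := fun h ↦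
        hnC (by simpa using Subgroup.mul_mem _ h (Subgroup.inv_mem _ (Subgroup.mem_zpowers c)))
      have h3 := hsq _ (Subgroup.mul_mem _ hn hc) h2
      apply hcc
      calc c * c = (n * n) * c * c := by rw [h1, one_mul]
        _ = n * (n * c) * c := by group
        _ = n * (c * n) * c := by rw [hnc]
        _ = n * c * (n * c) := by group
        _ = 1 := h3
    obtain ⟨k, rfl⟩ := Subgroup.mem_zpowers_iff.1 hnC
    exact (Commute.zpow_right (show Commute s c from hsc) k)
  · refine Subgroup.index_inf_le.trans ?_
    calc _ ≤ 2 * 2 := Nat.mul_le_mul hZ hWi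
      _ ≤ 8 := by norm_num

/-- The case of a kernel of exponent two and order at most four. The kernel is abelian, so that
conjugation by `Z.comap f` permutes it cyclically, and a permutation of four letters has order at
most four. -/
lemma exists_normal_abelian_of_exponent_two [Finite G] {H : Type*} [Group H] (f : G →* H)
    (Z : Subgroup H) [IsCyclic Z] (hZ : (Z.comap f).index ≤ 2)
    (hcard : Nat.card f.ker ≤ 4) (hsq : ∀ n ∈ f.ker, n * n = 1) :
    ∃ A : Subgroup G, A.Normal ∧ IsMulCommutative A ∧ A.index ≤ 8 := by
  have hinv : ∀ n ∈ f.ker, n⁻¹ = n := fun n hn ↦ inv_eq_of_mul_eq_one_left (hsq n hn)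
  have hker : ∀ a ∈ f.ker, ∀ b ∈ f.ker, a * b = b * a := fun a ha b hb ↦ by
    have := hinv _ (Subgroup.mul_mem _ ha hb)
    rw [mul_inv_rev, hinv a ha, hinv b hb] at this
    exact this.symm
  let φ : G →* Equiv.Perm f.ker := (MulAut.toPerm f.ker).comp MulAut.conjNormal
  have hφ : ∀ g, g ∈ φ.ker ↔ ∀ n ∈ f.ker, g * n = n * g := by
    intro g
    rw [MonoidHom.mem_ker, Equiv.ext_iff]
    constructor
    · intro h n hn
      have := congrArg Subtype.val (h ⟨n, hn⟩)
      exact mul_inv_eq_iff_eq_mul.1 this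
    · rintro h ⟨n, hn⟩
      exact Subtype.ext (mul_inv_eq_iff_eq_mul.2 (h n hn))
  have hPn := normal_of_index_le_two hZ
  refine ⟨Z.comap f ⊓ φ.ker, inferInstance, ?_, ?_⟩
  · refine isMulCommutative_of_map_le_isCyclic f Z _ inf_le_left fun n hn _ s hs ↦ ?_
    exact (hφ s).1 hs.2 n hn
  · have hcyc : IsCyclic ((Z.comap f).map f) :=
      isCyclic_of_injective (Subgroup.inclusion (Subgroup.map_comap_le f Z))
        (Subgroup.inclusion_injective _)
    obtain ⟨⟨_, h, hh, rfl⟩, hgen⟩ := hcyc.exists_generator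
    have hle : (Z.comap f).map φ ≤ Subgroup.zpowers (φ h) := by
      rintro _ ⟨p, hp, rfl⟩
      obtain ⟨k, hk⟩ := Subgroup.mem_zpowers_iff.1 (hgen ⟨f p, p, hp, rfl⟩)
      have hk' : f h ^ k = f p := by simpa using congrArg Subtype.val hk
      have hmem : (h ^ k)⁻¹ * p ∈ f.ker := by
        rw [MonoidHom.mem_ker, map_mul, map_inv, map_zpow, hk', inv_mul_cancel]
      have h1 : φ ((h ^ k)⁻¹ * p) = 1 :=
        MonoidHom.mem_ker.1 ((hφ _).2 fun n hn ↦ hker _ hmem n hn)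
      rw [map_mul, map_inv, map_zpow, inv_mul_eq_one] at h1
      exact Subgroup.mem_zpowers_iff.2 ⟨k, h1⟩
    rw [inf_comm]
    calc (φ.ker ⊓ Z.comap f).index
        = φ.ker.relIndex (Z.comap f) * (Z.comap f).index := by
          rw [← Subgroup.relIndex_mul_index (inf_le_right : φ.ker ⊓ Z.comap f ≤ Z.comap f),
            Subgroup.inf_relIndex_right]
      _ ≤ 4 * 2 := by
          refine Nat.mul_le_mul ?_ hZ
          rw [Subgroup.relIndex_ker]
          refine (Subgroup.card_le_of_le hle).trans ?_
          rw [Nat.card_zpowers]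
          exact orderOf_perm_le_four hcard _
      _ = 8 := by norm_num

/-- An extension of a group with a cyclic subgroup of index at most two by a dihedral group (with
cyclic subgroup `C` of rotations, all other elements being involutions) such that conjugation
raises no rotation to a power other than `±1` has a normal abelian subgroup of index at most
`8`. -/
theorem exists_normal_abelian_index_le_eight [Finite G] {H : Type*} [Group H] (f : G →* H)
    (Z : Subgroup H) [IsCyclic Z] (hZ : (Z.comap f).index ≤ 2)
    (C : Subgroup G) [IsCyclic C] (hC : C ≤ f.ker)
    (hmul : ∀ a ∈ f.ker, ∀ b ∈ f.ker, a ∉ C → b ∉ C → a * b ∈ C)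
    (hsq : ∀ n ∈ f.ker, n ∉ C → n * n = 1)
    (hconj : ∀ s ∈ f.ker, ∀ g : G, g * s * g⁻¹ ∈ Subgroup.zpowers s →
      g * s * g⁻¹ = s ∨ g * s * g⁻¹ = s⁻¹) :
    ∃ A : Subgroup G, A.Normal ∧ IsMulCommutative A ∧ A.index ≤ 8 := by
  obtain ⟨c, rfl⟩ := (Subgroup.isCyclic_iff_exists_zpowers_eq_top C).1 inferInstance
  have hc : c ∈ f.ker := hC (Subgroup.mem_zpowers c)
  by_cases hcc : c * c = 1
  · have hall : ∀ n ∈ f.ker, n * n = 1 := by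
      intro n hn
      by_cases hnC : n ∈ Subgroup.zpowers c
      · obtain ⟨k, rfl⟩ := Subgroup.mem_zpowers_iff.1 hnC
        rw [← (Commute.refl c).mul_zpow, hcc, one_zpow]
      · exact hsq n hn hnC
    refine exists_normal_abelian_of_exponent_two f Z hZ ?_ hall
    have h1 : ((Subgroup.zpowers c).subgroupOf f.ker).index ≤ 2 :=
      index_le_two_of_mul_mem fun a b ha hb ↦ hmul a a.2 b b.2 ha hb
    rw [← ((Subgroup.zpowers c).subgroupOf f.ker).card_mul_index]
    have h2 : Nat.card ((Subgroup.zpowers c).subgroupOf f.ker) ≤ 2 := by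
      rw [Nat.card_congr (Subgroup.subgroupOfEquivOfLe hC).toEquiv, Nat.card_zpowers]
      exact orderOf_le_of_pow_eq_one (by norm_num) (by rw [pow_two, hcc])
    calc _ ≤ 2 * 2 := Nat.mul_le_mul h2 h1
      _ = 4 := by norm_num
  · exact exists_normal_abelian_of_sq_ne_one f Z hZ c hc hcc hsq hconj

end GroupTheory

/-! ### Finite groups of Möbius transformations over an ordered field -/

section ProjectiveRepresentation

open Matrix

variable {Γ F : Type*} [Group Γ] [Field F]

/-- A map `M` from a group to invertible `2 × 2` matrices that is an injective antihomomorphism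
modulo scalars. It encodes a faithful action on the projective line. -/
structure IsProjRep (M : Γ → Matrix (Fin 2) (Fin 2) F) : Prop where
  det_ne_zero : ∀ γ, (M γ).det ≠ 0
  mul : ∀ γ δ, ∃ c : F, M δ * M γ = c • M (γ * δ)
  eq_one : ∀ γ (c : F), M γ = c • 1 → γ = 1

/-- The skew matrix `!![0, 1; -1, 0]`. -/
def skew : Matrix (Fin 2) (Fin 2) F := !![0, 1; -1, 0]

lemma skew_mul_adjugate_transpose (M : Matrix (Fin 2) (Fin 2) F) :
    skew * M.adjugateᵀ = M * skew := by
  rw [adjugate_fin_two]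
  ext i j
  fin_cases i <;> fin_cases j <;> simp [skew, Matrix.mul_apply, Fin.sum_univ_two]

/-- A similitude `M` of the quadratic form `Q` with multiplier `s * det M` commutes with the
matrix `skew * Q` up to the factor `s`. -/
lemma skew_mul_mul_eq {M Q : Matrix (Fin 2) (Fin 2) F} (hM : M.det ≠ 0) {s : F}
    (h : Mᵀ * Q * M = (s * M.det) • Q) : skew * Q * M = s • (M * (skew * Q)) := by
  have h1 : M.adjugateᵀ * Mᵀ = M.det • 1 := by
    rw [← transpose_mul, mul_adjugate, transpose_smul, transpose_one]
  have h2 : M.det • (Q * M) = M.det • (s • (M.adjugateᵀ * Q)) := by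
    calc M.det • (Q * M) = (M.adjugateᵀ * Mᵀ) * (Q * M) := by
          rw [h1, smul_mul_assoc, one_mul]
      _ = M.adjugateᵀ * (Mᵀ * Q * M) := by simp only [Matrix.mul_assoc]
      _ = _ := by rw [h, Matrix.mul_smul, mul_comm s, mul_smul]
  have h3 := smul_right_injective _ hM h2
  rw [Matrix.mul_assoc, h3, Matrix.mul_smul, ← Matrix.mul_assoc, skew_mul_adjugate_transpose,
    Matrix.mul_assoc]

variable [LinearOrder F] [IsStrictOrderedRing F] {M : Γ → Matrix (Fin 2) (Fin 2) F}

/-- Averaging yields a positive definite form that the projective representation preserves up to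
scalars. The weights `|det|⁻¹` make the average independent of the choice of the matrices. -/
lemma IsProjRep.exists_invariant_form [Finite Γ] (hM : IsProjRep M) :
    ∃ A B C : F, 0 < A ∧ 0 < A * C - B ^ 2 ∧
      ∀ γ, (M γ)ᵀ * !![A, B; B, C] * M γ = |(M γ).det| • !![A, B; B, C] := by
  have := Fintype.ofFinite Γ
  let Q : Matrix (Fin 2) (Fin 2) F := ∑ δ, |(M δ).det|⁻¹ • ((M δ)ᵀ * M δ)
  have hQ10 : Q 1 0 = Q 0 1 := by
    simp only [Q, Matrix.sum_apply, Matrix.smul_apply, Matrix.mul_apply, transpose_apply]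
    simp only [mul_comm]
  have hform : ∀ x y : F, Q 0 0 * x ^ 2 + 2 * Q 0 1 * x * y + Q 1 1 * y ^ 2 =
      ∑ δ, |(M δ).det|⁻¹ * ((M δ 0 0 * x + M δ 0 1 * y) ^ 2 + (M δ 1 0 * x + M δ 1 1 * y) ^ 2) := by
    intro x y
    simp only [Q, Matrix.sum_apply, Matrix.smul_apply, Matrix.mul_apply, transpose_apply,
      Fin.sum_univ_two, Finset.sum_mul, Finset.mul_sum, ← Finset.sum_add_distrib, smul_eq_mul]
    exact Finset.sum_congr rfl fun δ _ ↦ by ring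
  have hpos : ∀ x y : F, x ≠ 0 ∨ y ≠ 0 →
      0 < Q 0 0 * x ^ 2 + 2 * Q 0 1 * x * y + Q 1 1 * y ^ 2 := by
    intro x y hxy
    rw [hform]
    refine Finset.sum_pos (fun δ _ ↦ ?_) ⟨1, Finset.mem_univ _⟩
    have hd := hM.det_ne_zero δ
    refine mul_pos (inv_pos.2 (abs_pos.2 hd)) ?_
    by_contra hneg
    have hs0 := sq_nonneg (M δ 0 0 * x + M δ 0 1 * y)
    have hs1 := sq_nonneg (M δ 1 0 * x + M δ 1 1 * y)
    have h1 : M δ 0 0 * x + M δ 0 1 * y = 0 :=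
      (pow_eq_zero_iff two_ne_zero).1 (le_antisymm (by linarith) hs0)
    have h2 : M δ 1 0 * x + M δ 1 1 * y = 0 :=
      (pow_eq_zero_iff two_ne_zero).1 (le_antisymm (by linarith) hs1)
    rw [det_fin_two] at hd
    have hx : (M δ 0 0 * M δ 1 1 - M δ 0 1 * M δ 1 0) * x = 0 := by
      linear_combination M δ 1 1 * h1 - M δ 0 1 * h2
    have hy : (M δ 0 0 * M δ 1 1 - M δ 0 1 * M δ 1 0) * y = 0 := by
      linear_combination M δ 0 0 * h2 - M δ 1 0 * h1
    rcases hxy with h | h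
    · exact h ((mul_eq_zero.1 hx).resolve_left hd)
    · exact h ((mul_eq_zero.1 hy).resolve_left hd)
  have hA : 0 < Q 0 0 := by simpa using hpos 1 0 (Or.inl one_ne_zero)
  refine ⟨Q 0 0, Q 0 1, Q 1 1, hA, ?_, fun γ ↦ ?_⟩
  · have h1 := hpos (-Q 0 1) (Q 0 0) (Or.inr hA.ne')
    exact (mul_pos_iff_of_pos_left hA).1 (h1.trans_eq (by ring))
  · have hQ : !![Q 0 0, Q 0 1; Q 0 1, Q 1 1] = Q := by
      ext i j
      fin_cases i <;> fin_cases j <;> simp [hQ10]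
    rw [hQ]
    simp only [Q, Matrix.mul_sum, Matrix.sum_mul, Finset.smul_sum]
    refine Fintype.sum_equiv (Equiv.mulLeft γ) _ _ fun δ ↦ ?_
    obtain ⟨c, hc⟩ := hM.mul γ δ
    have hdet := congrArg Matrix.det hc
    rw [det_mul, det_smul, Fintype.card_fin] at hdet
    have hd := hM.det_ne_zero δ
    have hd' := hM.det_ne_zero γ
    have hd'' := hM.det_ne_zero (γ * δ)
    have hc0 : c ≠ 0 := by
      rintro rfl
      simp [hd, hd'] at hdet
    have habs : |(M δ).det| * |(M γ).det| = c ^ 2 * |(M (γ * δ)).det| := by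
      rw [← abs_mul, hdet, abs_mul, abs_of_nonneg (sq_nonneg c)]
    have hmat : (M γ)ᵀ * ((M δ)ᵀ * M δ) * M γ = c ^ 2 • ((M (γ * δ))ᵀ * M (γ * δ)) := by
      calc (M γ)ᵀ * ((M δ)ᵀ * M δ) * M γ = (M δ * M γ)ᵀ * (M δ * M γ) := by
            simp only [transpose_mul, Matrix.mul_assoc]
        _ = _ := by rw [hc, transpose_smul, smul_mul_smul_comm, pow_two]
    rw [Equiv.coe_mulLeft, Matrix.mul_smul, Matrix.smul_mul, hmat, smul_smul, smul_smul]
    congr 1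
    have h1 := abs_ne_zero.2 hd
    have h2 := abs_ne_zero.2 hd''
    field_simp
    linear_combination -habs

/-- A finite group with a faithful action on the projective line over an ordered field is cyclic
or dihedral: the elements that commute with `J = skew * Q`, for an invariant positive definite form
`Q`, are embedded in a field by the ratio of their two eigenvalues, and all other elements
anticommute with `J`. -/
theorem IsProjRep.exists_isCyclic [Finite Γ] (hM : IsProjRep M) :
    ∃ C : Subgroup Γ, IsCyclic C ∧ (∀ a b, a ∉ C → b ∉ C → a * b ∈ C) ∧
      ∀ a, a ∉ C → a * a = 1 := by
  obtain ⟨A, B, D, hA, hΔ, hinv⟩ := hM.exists_invariant_form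
  set J : Matrix (Fin 2) (Fin 2) F := skew * !![A, B; B, D] with hJ
  have hJe : J = !![B, D; -A, -B] := by
    ext i j
    fin_cases i <;> fin_cases j <;> simp [hJ, skew]
  have hJdet : J.det ≠ 0 := by
    rw [hJe, det_fin_two_of]
    exact ne_of_gt (by linarith)
  have hor : ∀ γ, J * M γ = M γ * J ∨ J * M γ = -(M γ * J) := by
    intro γ
    rcases abs_choice (M γ).det with h | h
    · left
      have := skew_mul_mul_eq (hM.det_ne_zero γ) (s := 1) (by rw [hinv γ, h, one_mul])
      simpa using this
    · right
      have := skew_mul_mul_eq (hM.det_ne_zero γ) (s := -1) (by rw [hinv γ, h, neg_one_mul])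
      simpa using this
  have hscal : ∀ γ δ, ∃ c : F, c ≠ 0 ∧ M δ * M γ = c • M (γ * δ) := by
    intro γ δ
    obtain ⟨c, hc⟩ := hM.mul γ δ
    refine ⟨c, ?_, hc⟩
    rintro rfl
    have hdet := congrArg Matrix.det hc
    simp [hM.det_ne_zero] at hdet
  have hone : M 1 = (M 1).trace • ((2 : F)⁻¹ • 1) ∧ J * M 1 = M 1 * J := by
    obtain ⟨c, hc, h⟩ := hscal 1 1
    rw [mul_one] at h
    have hM1 : M 1 = c • 1 := by
      have h2 : (M 1).adjugate * (M 1 * M 1) = (M 1).adjugate * (c • M 1) := by rw [h]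
      rw [← Matrix.mul_assoc, adjugate_mul, Matrix.mul_smul, adjugate_mul, smul_mul_assoc, one_mul,
        smul_comm] at h2
      exact smul_right_injective _ (hM.det_ne_zero 1) h2
    rw [hM1]
    refine ⟨?_, by simp⟩
    rw [trace_smul, trace_one, smul_smul]
    congr 1
    simp
  have hcomm_mul : ∀ γ δ, J * (M δ * M γ) = M δ * M γ * J → J * M (γ * δ) = M (γ * δ) * J := by
    intro γ δ h
    obtain ⟨c, hc, h1⟩ := hscal γ δ
    rw [h1, Matrix.mul_smul, Matrix.smul_mul] at h
    exact smul_right_injective _ hc h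
  let C : Subgroup Γ :=
    { carrier := {γ | J * M γ = M γ * J}
      one_mem' := hone.2
      mul_mem' := by
        intro γ δ (hγ : J * M γ = M γ * J) (hδ : J * M δ = M δ * J)
        refine hcomm_mul γ δ ?_
        rw [← Matrix.mul_assoc, hδ, Matrix.mul_assoc, hγ, Matrix.mul_assoc]
      inv_mem' := by
        intro γ (hγ : J * M γ = M γ * J)
        obtain ⟨c, hc, h⟩ := hscal γ γ⁻¹
        rw [mul_inv_cancel] at h
        have h2 : J * M γ⁻¹ * M γ = M γ⁻¹ * J * M γ := by
          rw [Matrix.mul_assoc, h, Matrix.mul_smul, hone.2, ← Matrix.smul_mul, ← h,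
            Matrix.mul_assoc, Matrix.mul_assoc, hγ]
        have hu : IsUnit (M γ) := (isUnit_iff_isUnit_det _).2 (hM.det_ne_zero γ).isUnit
        exact hu.mul_left_injective h2 }
  have hC : ∀ γ, γ ∈ C ↔ J * M γ = M γ * J := fun γ ↦ Iff.rfl
  have hnC : ∀ γ, γ ∉ C → J * M γ = -(M γ * J) := fun γ hγ ↦ (hor γ).resolve_left hγ
  refine ⟨C, ?_, fun a b ha hb ↦ ?_, fun a ha ↦ ?_⟩
  · -- Over a field with a square root `j` of `-det`, the eigenvalue of `M γ` on the eigenvector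
    -- `(-(B + j), A)` of `J` is `lam γ j`.
    obtain ⟨j, hj⟩ := IsAlgClosed.exists_pow_nat_eq
      (algebraMap F (AlgebraicClosure F) (B ^ 2 - A * D)) (zero_lt_two)
    let φ := algebraMap F (AlgebraicClosure F)
    have hφA : φ A ≠ 0 := by simpa [φ] using hA.ne'
    have hj0 : j ≠ 0 := by
      rintro rfl
      have : φ (B ^ 2 - A * D) = 0 := by rw [← hj]; simp
      rw [map_eq_zero] at this
      linarith
    have hj' : j ^ 2 = φ B ^ 2 - φ A * φ D := by rw [hj]; simp [φ]
    have hent : ∀ γ ∈ C, M γ 0 1 * A = - (D * M γ 1 0) ∧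
        A * (M γ 1 1 - M γ 0 0) = 2 * B * M γ 1 0 := by
      intro γ hγ
      rw [hC, hJe] at hγ
      have h00 := congrFun (congrFun hγ 0) 0
      have h10 := congrFun (congrFun hγ 1) 0
      simp only [Matrix.mul_apply, Fin.sum_univ_two, Matrix.of_apply, Matrix.cons_val_zero,
        Matrix.cons_val_one, Matrix.cons_val', Matrix.cons_val_fin_one] at h00 h10
      constructor
      · linear_combination h00
      · linear_combination h10
    let lam : Γ → AlgebraicClosure F → AlgebraicClosure F := fun γ i ↦
      φ (M γ 1 1) - φ (M γ 1 0) * (φ B + i) / φ A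
    have hlam : ∀ γ ∈ C, ∀ δ ∈ C, ∀ c, M δ * M γ = c • M (γ * δ) → ∀ i, i ^ 2 = j ^ 2 →
        lam δ i * lam γ i = φ c * lam (γ * δ) i := by
      intro γ hγ δ hδ c hc i hi
      have h10 := congrArg φ (congrFun (congrFun hc 1) 0)
      have h11 := congrArg φ (congrFun (congrFun hc 1) 1)
      simp only [Matrix.mul_apply, Fin.sum_univ_two, Matrix.smul_apply, smul_eq_mul, map_add,
        map_mul] at h10 h11
      obtain ⟨h1, h2⟩ := hent γ hγ
      replace h1 := congrArg φ h1
      replace h2 := congrArg φ h2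
      simp only [map_mul, map_neg, map_sub, map_ofNat] at h1 h2
      rw [hj'] at hi
      have hci : φ c * (φ (M (γ * δ) 1 1) * φ A - φ (M (γ * δ) 1 0) * (φ B + i)) =
        (φ (M δ 1 0) * φ (M γ 0 1) + φ (M δ 1 1) * φ (M γ 1 1)) * φ A -
          (φ (M δ 1 0) * φ (M γ 0 0) + φ (M δ 1 1) * φ (M γ 1 0)) * (φ B + i) := by
        rw [h10, h11]; ring
      simp only [lam]
      field_simp
      linear_combination (-φ A) * hci + (-φ A * φ (M δ 1 0)) * h1 +
        (-φ (M δ 1 0) * (φ B + i)) * h2 + φ (M δ 1 0) * φ (M γ 1 0) * hi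
    have hlam0 : ∀ γ ∈ C, ∀ i, i ^ 2 = j ^ 2 → lam γ i ≠ 0 := by
      intro γ hγ i hi h0
      obtain ⟨c, hc, h⟩ := hscal γ γ⁻¹
      have h1 := hlam γ hγ γ⁻¹ (C.inv_mem hγ) c h i hi
      rw [h0, mul_zero, mul_inv_cancel] at h1
      have h2 : lam 1 i ≠ 0 := by
        have h10 := congrFun (congrFun hone.1 1) 0
        have hd := hM.det_ne_zero 1
        rw [det_fin_two] at hd
        simp only [Matrix.smul_apply, Matrix.one_apply_ne (one_ne_zero : (1 : Fin 2) ≠ 0),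
          smul_zero] at h10
        have h11 : M 1 1 1 ≠ 0 := by
          intro h; apply hd; rw [h10, h]; ring
        simpa [lam, h10, φ] using h11
      have hφc : φ c ≠ 0 := by simpa [φ] using hc
      exact (mul_ne_zero hφc h2) h1.symm
    have hneg : (-j) ^ 2 = j ^ 2 := by ring
    let χ : C →* AlgebraicClosure F :=
      { toFun := fun γ ↦ lam γ j / lam γ (-j)
        map_one' := by
          have h := hone.1
          have h10 := congrFun (congrFun hone.1 1) 0
          simp only [Matrix.smul_apply, Matrix.one_apply_ne (one_ne_zero : (1 : Fin 2) ≠ 0),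
            smul_zero] at h10
          have h2 := hlam0 1 C.one_mem j rfl
          have : lam 1 j = lam 1 (-j) := by simp [lam, h10]
          rw [OneMemClass.coe_one, ← this, div_self h2]
        map_mul' := by
          rintro ⟨γ, hγ⟩ ⟨δ, hδ⟩
          obtain ⟨c, hc, h⟩ := hscal γ δ
          have h1 := hlam γ hγ δ hδ c h j rfl
          have h2 := hlam γ hγ δ hδ c h (-j) hneg
          have hφc : φ c ≠ 0 := by simpa [φ] using hc
          change lam (γ * δ) j / lam (γ * δ) (-j) = _
          rw [div_mul_div_comm, mul_comm (lam γ j), mul_comm (lam γ (-j)), h1, h2,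
            mul_div_mul_left _ _ hφc] }
    refine isCyclic_of_injective_ringHom (R := AlgebraicClosure F) χ ?_
    rw [injective_iff_map_eq_one]
    rintro ⟨γ, hγ⟩ h
    change lam γ j / lam γ (-j) = 1 at h
    rw [div_eq_one_iff_eq (hlam0 γ hγ _ hneg)] at h
    simp only [lam, sub_right_inj] at h
    field_simp at h
    have h10 : M γ 1 0 = 0 := by
      by_contra hne
      have hne' : φ (M γ 1 0) ≠ 0 := by simpa [φ] using hne
      have h2 := mul_left_cancel₀ hne' h
      have : (2 : AlgebraicClosure F) * j = 0 := by linear_combination h2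
      simp [hj0] at this
    obtain ⟨h1, h2⟩ := hent γ hγ
    rw [h10] at h1 h2
    have h01 : M γ 0 1 = 0 := by simpa [hA.ne'] using h1
    have h11 : M γ 1 1 = M γ 0 0 := by
      simpa [hA.ne', sub_eq_zero] using h2
    refine Subtype.ext (hM.eq_one γ (M γ 0 0) ?_)
    ext i k
    fin_cases i <;> fin_cases k <;> simp [h10, h01, h11]
  · rw [hC]
    refine hcomm_mul a b ?_
    rw [← Matrix.mul_assoc, hnC b hb, Matrix.neg_mul, Matrix.mul_assoc, hnC a ha, Matrix.mul_neg,
      neg_neg, Matrix.mul_assoc]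
  · have htr : (M a).trace = 0 := by
      have hu : IsUnit J.det := hJdet.isUnit
      have h1 : (J * M a * J⁻¹).trace = (M a).trace := by
        rw [Matrix.trace_mul_cycle, Matrix.nonsing_inv_mul _ hu, one_mul]
      rw [hnC a ha, Matrix.neg_mul, Matrix.mul_assoc, Matrix.mul_nonsing_inv _ hu, mul_one,
        trace_neg] at h1
      linarith
    obtain ⟨c, hc, h⟩ := hscal a a
    refine hM.eq_one _ (c⁻¹ * -(M a).det) ?_
    have hsq : M a * M a = (-(M a).det) • 1 := by
      rw [trace_fin_two] at htr
      have h11 : M a 1 1 = -M a 0 0 := by linear_combination htr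
      rw [det_fin_two]
      ext i k
      fin_cases i <;> fin_cases k <;> simp [Matrix.mul_apply, Fin.sum_univ_two, h11] <;> ring
    rw [mul_smul, ← hsq, h, smul_smul, inv_mul_cancel₀ hc, one_smul]

end ProjectiveRepresentation

/-! ### Automorphisms of the field of rational functions -/

section Moebius

open Matrix

variable {A : Type*} [Field A]

/-- The rational function `f` is the fractional linear function with matrix `M`. -/
def IsMoebius (M : Matrix (Fin 2) (Fin 2) A) (f : RatFunc A) : Prop :=
  f * (RatFunc.C (M 1 0) * RatFunc.X + RatFunc.C (M 1 1)) =
    RatFunc.C (M 0 0) * RatFunc.X + RatFunc.C (M 0 1)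

lemma linear_eq_zero {a b : A} (h : RatFunc.C a * RatFunc.X + RatFunc.C b = 0) :
    a = 0 ∧ b = 0 := by
  have h1 : algebraMap (Polynomial A) (RatFunc A) (Polynomial.C a * Polynomial.X + Polynomial.C b) =
      0 := by simpa using h
  have h2 := (map_eq_zero_iff _ (RatFunc.algebraMap_injective A)).1 h1
  constructor
  · simpa using congrArg (fun p ↦ Polynomial.coeff p 1) h2
  · simpa using congrArg (fun p ↦ Polynomial.coeff p 0) h2

lemma quadratic_eq_zero {a b c : A}
    (h : RatFunc.C a * RatFunc.X ^ 2 + RatFunc.C b * RatFunc.X + RatFunc.C c = 0) :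
    a = 0 ∧ b = 0 ∧ c = 0 := by
  have h1 : algebraMap (Polynomial A) (RatFunc A)
      (Polynomial.C a * Polynomial.X ^ 2 + Polynomial.C b * Polynomial.X + Polynomial.C c) =
      0 := by simpa using h
  have h2 := (map_eq_zero_iff _ (RatFunc.algebraMap_injective A)).1 h1
  refine ⟨?_, ?_, ?_⟩
  · simpa [Polynomial.coeff_X, Polynomial.coeff_C] using congrArg (fun p ↦ Polynomial.coeff p 2) h2
  · simpa [Polynomial.coeff_X, Polynomial.coeff_C] using congrArg (fun p ↦ Polynomial.coeff p 1) h2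
  · simpa [Polynomial.coeff_X, Polynomial.coeff_C] using congrArg (fun p ↦ Polynomial.coeff p 0) h2

lemma IsMoebius.unique {M M' : Matrix (Fin 2) (Fin 2) A} {f : RatFunc A} (hM : IsMoebius M f)
    (hM' : IsMoebius M' f) (hdet : M.det ≠ 0) : ∃ c : A, M' = c • M := by
  rw [det_fin_two] at hdet
  have hne : RatFunc.C (M 1 0) * RatFunc.X + RatFunc.C (M 1 1) ≠ 0 := by
    intro h
    obtain ⟨h1, h2⟩ := linear_eq_zero h
    apply hdet
    rw [h1, h2]; ring
  have h : RatFunc.C (M 0 0 * M' 1 0 - M' 0 0 * M 1 0) * RatFunc.X ^ 2 +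
      RatFunc.C (M 0 0 * M' 1 1 + M 0 1 * M' 1 0 - M' 0 0 * M 1 1 - M' 0 1 * M 1 0) * RatFunc.X +
      RatFunc.C (M 0 1 * M' 1 1 - M' 0 1 * M 1 1) = 0 := by
    simp only [map_sub, map_mul, map_add]
    unfold IsMoebius at hM hM'
    linear_combination (RatFunc.C (M 1 0) * RatFunc.X + RatFunc.C (M 1 1)) * hM' -
      (RatFunc.C (M' 1 0) * RatFunc.X + RatFunc.C (M' 1 1)) * hM
  obtain ⟨h1, h2, h3⟩ := quadratic_eq_zero h
  refine ⟨(M 1 1 * M' 0 0 - M 0 1 * M' 1 0) / (M 0 0 * M 1 1 - M 0 1 * M 1 0), ?_⟩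
  ext i j
  fin_cases i <;> fin_cases j <;>
    simp only [Fin.zero_eta, Fin.mk_one, Matrix.smul_apply, smul_eq_mul, div_mul_eq_mul_div,
      eq_div_iff hdet]
  · linear_combination M 0 1 * h1
  · linear_combination M 0 1 * h2 - M 0 0 * h3
  · linear_combination M 1 1 * h1
  · linear_combination M 1 1 * h2 - M 1 0 * h3

lemma IsMoebius.comp {M M' : Matrix (Fin 2) (Fin 2) A} {f : RatFunc A} {τ : A →+* A}
    {θ : RatFunc A →+* RatFunc A} (hθ : ∀ a, θ (RatFunc.C a) = RatFunc.C (τ a))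
    (hM : IsMoebius M (θ RatFunc.X)) (hM' : IsMoebius M' f) :
    IsMoebius (M'.map τ * M) (θ f) := by
  have h := congrArg θ hM'
  simp only [map_mul, map_add, hθ] at h
  unfold IsMoebius at hM ⊢
  simp only [Matrix.mul_apply, Fin.sum_univ_two, Matrix.map_apply, map_add, map_mul]
  linear_combination (RatFunc.C (M 1 0) * RatFunc.X + RatFunc.C (M 1 1)) * h +
    (RatFunc.C (τ (M' 0 0)) - θ f * RatFunc.C (τ (M' 1 0))) * hM

lemma IsMoebius.comp' {M M' : Matrix (Fin 2) (Fin 2) A} {f : RatFunc A}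
    {θ : RatFunc A ≃ₐ[A] RatFunc A}
    (hM : IsMoebius M (θ RatFunc.X)) (hM' : IsMoebius M' f) :
    IsMoebius (M' * M) (θ f) := by
  have := IsMoebius.comp (τ := RingHom.id A) (θ := θ.toRingEquiv.toRingHom)
    (fun a ↦ by simpa using θ.commutes a) hM hM'
  simpa using this

/-- Every automorphism of `A(X)` over `A` is a Möbius transformation: `A(X)` has degree one over
`A(θ X)`, and this degree is the degree of the rational function `θ X`. -/
lemma exists_isMoebius (θ : RatFunc A ≃ₐ[A] RatFunc A) :
    ∃ M : Matrix (Fin 2) (Fin 2) A, M.det ≠ 0 ∧ IsMoebius M (θ RatFunc.X) := by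
  set f := θ RatFunc.X with hf
  have htop : IntermediateField.adjoin A {f} = ⊤ := by
    have := congrArg (IntermediateField.map (θ : RatFunc A →ₐ[A] RatFunc A))
      (RatFunc.adjoin_X (K := A))
    rw [IntermediateField.adjoin_map, Set.image_singleton] at this
    rw [hf]
    refine Eq.trans this ?_
    rw [eq_top_iff]
    intro z _
    exact ⟨θ.symm z, trivial, θ.apply_symm_apply z⟩
  have hdeg := RatFunc.finrank_eq_max_natDegree f
  rw [htop, IntermediateField.finrank_top] at hdeg
  have hnum : f.num.natDegree ≤ 1 := hdeg ▸ le_max_left _ _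
  have hden : f.denom.natDegree ≤ 1 := hdeg ▸ le_max_right _ _
  obtain ⟨a, b, hab⟩ := Polynomial.exists_eq_X_add_C_of_natDegree_le_one hnum
  obtain ⟨c, d, hcd⟩ := Polynomial.exists_eq_X_add_C_of_natDegree_le_one hden
  have hM : IsMoebius !![a, b; c, d] f := by
    have h := RatFunc.num_div_denom f
    rw [div_eq_iff (by simpa using f.denom_ne_zero)] at h
    unfold IsMoebius
    simp only [Matrix.of_apply, Matrix.cons_val_zero, Matrix.cons_val_one, Matrix.cons_val',
      Matrix.cons_val_fin_one]
    rw [hab, hcd] at h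
    simpa using h.symm
  refine ⟨_, ?_, hM⟩
  intro hdet
  rw [det_fin_two_of] at hdet
  -- If the determinant vanishes, numerator and denominator are not coprime.
  have hcop := f.isCoprime_num_denom
  rw [hab, hcd] at hcop
  have hmax : ¬ (f.num.natDegree = 0 ∧ f.denom.natDegree = 0) := by
    rintro ⟨h1, h2⟩
    simp [h1, h2] at hdeg
  by_cases hc : c = 0
  · have hd : d ≠ 0 := by
      rintro rfl
      exact f.denom_ne_zero (by simp [hcd, hc])
    have ha : a = 0 := by simpa [hc, hd] using hdet
    exact hmax ⟨by simp [hab, ha], by simp [hcd, hc]⟩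
  · have hdvd : Polynomial.C c * Polynomial.X + Polynomial.C d ∣
        Polynomial.C a * Polynomial.X + Polynomial.C b := by
      refine ⟨Polynomial.C (a / c), ?_⟩
      have h1 : c * (a / c) = a := by field_simp
      have h2 : d * (a / c) = b := by field_simp; linear_combination hdet
      rw [add_mul, mul_right_comm, ← Polynomial.C_mul, ← Polynomial.C_mul, h1, h2]
    have hunit := hcop.symm.isUnit_of_dvd' dvd_rfl hdvd
    have := Polynomial.natDegree_eq_zero_of_isUnit hunit
    rw [Polynomial.natDegree_linear hc] at this
    exact one_ne_zero this

lemma algEquiv_eq_one_of_apply_X {θ : RatFunc A ≃ₐ[A] RatFunc A}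
    (h : θ RatFunc.X = RatFunc.X) : θ = 1 := by
  have hle : IntermediateField.adjoin A {(RatFunc.X : RatFunc A)} ≤
      IntermediateField.fixedField (Subgroup.zpowers θ) := by
    rw [IntermediateField.adjoin_simple_le_iff]
    rintro ⟨σ, hσ⟩
    obtain ⟨k, rfl⟩ := Subgroup.mem_zpowers_iff.1 hσ
    have hfix : θ ∈ MulAction.stabilizer (RatFunc A ≃ₐ[A] RatFunc A) (RatFunc.X : RatFunc A) := h
    exact Subgroup.zpow_mem _ hfix k
  rw [RatFunc.adjoin_X] at hle
  ext z
  exact (hle (show z ∈ ⊤ from trivial)) ⟨θ, Subgroup.mem_zpowers θ⟩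

lemma IsMoebius.eq_one {θ : RatFunc A ≃ₐ[A] RatFunc A} {M : Matrix (Fin 2) (Fin 2) A}
    (hM : IsMoebius M (θ RatFunc.X)) (hdet : M.det ≠ 0) {c : A} (hc : M = c • 1) : θ = 1 := by
  have hc0 : RatFunc.C c ≠ 0 := by
    rw [map_ne_zero]
    rintro rfl
    simp [hc] at hdet
  refine algEquiv_eq_one_of_apply_X ?_
  rw [hc] at hM
  unfold IsMoebius at hM
  simp only [Matrix.smul_apply, Matrix.one_apply_eq, smul_eq_mul, mul_one, ne_eq, one_ne_zero,
    not_false_eq_true, Matrix.one_apply_ne, mul_zero, map_zero, zero_mul, zero_add, zero_ne_one,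
    add_zero] at hM
  rw [mul_comm] at hM
  exact mul_left_cancel₀ hc0 hM

/-- A finite group of automorphisms of `F(X)` over an ordered field `F` is cyclic or dihedral. -/
theorem exists_isCyclic_of_ratFunc {Γ F : Type*} [Group Γ] [Finite Γ] [Field F] [LinearOrder F]
    [IsStrictOrderedRing F] (ρ : Γ →* (RatFunc F ≃ₐ[F] RatFunc F)) (hρ : Function.Injective ρ) :
    ∃ C : Subgroup Γ, IsCyclic C ∧ (∀ a b, a ∉ C → b ∉ C → a * b ∈ C) ∧
      ∀ a, a ∉ C → a * a = 1 := by
  choose M hdet hM using fun γ ↦ exists_isMoebius (ρ γ)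
  refine IsProjRep.exists_isCyclic (M := M) ⟨hdet, fun γ δ ↦ ?_, fun γ c hc ↦ ?_⟩
  · have h : IsMoebius (M δ * M γ) (ρ (γ * δ) RatFunc.X) := by
      rw [map_mul]
      exact (hM γ).comp' (hM δ)
    exact (hM _).unique h (hdet _)
  · exact hρ (by rw [map_one]; exact (hM γ).eq_one (hdet γ) hc)

lemma isMoebius_pow {θ : RatFunc A ≃ₐ[A] RatFunc A} {M : Matrix (Fin 2) (Fin 2) A}
    (hM : IsMoebius M (θ RatFunc.X)) (k : ℕ) : IsMoebius (M ^ k) ((θ ^ k) RatFunc.X) := by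
  induction k with
  | zero => simp [IsMoebius]
  | succ k ih =>
    rw [pow_succ, pow_succ']
    exact hM.comp' ih

lemma mul_self_fin_two (M : Matrix (Fin 2) (Fin 2) A) : M * M = M.trace • M - M.det • 1 := by
  rw [det_fin_two, trace_fin_two]
  ext i j
  fin_cases i <;> fin_cases j <;> simp [Matrix.mul_apply, Fin.sum_univ_two] <;> ring

lemma trace_pow_fin_two {M : Matrix (Fin 2) (Fin 2) A} {l m : A} (htr : M.trace = l + m)
    (hdet : M.det = l * m) (k : ℕ) : (M ^ k).trace = l ^ k + m ^ k := by
  induction k using Nat.strong_induction_on with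
  | _ k ih =>
    match k with
    | 0 => simp [one_add_one_eq_two]
    | 1 => simpa using htr
    | k + 2 =>
      have h : M ^ (k + 2) = M.trace • M ^ (k + 1) - M.det • M ^ k := by
        rw [pow_add, pow_two, mul_self_fin_two, Matrix.mul_sub, Matrix.mul_smul, Matrix.mul_smul,
          mul_one, ← pow_succ]
      rw [h, trace_sub, trace_smul, trace_smul, ih (k + 1) (by omega), ih k (by omega), htr, hdet,
        smul_eq_mul, smul_eq_mul]
      ring

lemma smul_one_add_pow {N : Matrix (Fin 2) (Fin 2) A} (hN : N * N = 0) (p : A) (n : ℕ) :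
    (p • 1 + N) ^ (n + 1) = p ^ (n + 1) • 1 + ((n + 1 : ℕ) * p ^ n : A) • N := by
  induction n with
  | zero => simp
  | succ n ih =>
    rw [pow_succ, ih, add_mul, mul_add, mul_add, smul_mul_smul_comm, mul_one, smul_mul_smul_comm,
      mul_one, smul_mul_assoc _ N, hN, smul_zero, add_zero, smul_mul_assoc, one_mul, add_assoc,
      ← add_smul]
    congr 2 <;> push_cast <;> ring

/-- An invertible matrix of finite order modulo scalars with a double eigenvalue is scalar, in
characteristic zero. -/
lemma eq_smul_one_of_pow_eq [CharZero A] {P : Matrix (Fin 2) (Fin 2) A} {p : A} (hp : p ≠ 0)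
    (htr : P.trace = 2 * p) (hdet : P.det = p ^ 2) {n : ℕ} {s : A} (h : P ^ (n + 1) = s • 1) :
    P = p • 1 := by
  have hN : (P - p • 1) * (P - p • 1) = 0 := by
    rw [sub_mul, mul_sub, mul_sub, mul_self_fin_two, htr, hdet, smul_mul_smul_comm, mul_one,
      smul_mul_assoc, one_mul, Matrix.mul_smul, mul_one, two_mul, add_smul, pow_two]
    abel
  have h1 : P = p • 1 + (P - p • 1) := by abel
  rw [h1, smul_one_add_pow hN] at h
  have hk : ((n + 1 : ℕ) * p ^ n : A) ≠ 0 :=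
    mul_ne_zero (Nat.cast_ne_zero.2 n.succ_ne_zero) (pow_ne_zero _ hp)
  set k := ((n + 1 : ℕ) * p ^ n : A)
  have h2 : P - p • 1 = (k⁻¹ * (s - p ^ (n + 1))) • 1 := by
    rw [mul_smul, sub_smul, ← h, add_sub_cancel_left, smul_smul, inv_mul_cancel₀ hk, one_smul]
  rw [h2, smul_mul_smul_comm, mul_one] at hN
  have h3 := congrFun (congrFun hN 0) 0
  simp only [Matrix.smul_apply, Matrix.one_apply_eq, smul_eq_mul, mul_one, Matrix.zero_apply,
    mul_self_eq_zero] at h3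
  rw [h3, zero_smul, sub_eq_zero] at h2
  exact h2

/-- If a semilinear automorphism `Θ` of `A(X)` conjugates an automorphism `σ` of finite order to
its power `σ ^ (k + 1)`, and the action of `Θ` on the constants fixes `ξ + ξ⁻¹` for all roots of
unity `ξ`, then `σ ^ (k + 1)` is `σ` or `σ⁻¹`: the trace squared over the determinant of the matrix
of `σ` is `ξ + ξ⁻¹ + 2`, where `ξ` is the ratio of the eigenvalues. -/
lemma pow_eq_one_or_of_conj [IsAlgClosed A] [CharZero A] (σ : RatFunc A ≃ₐ[A] RatFunc A) {n : ℕ}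
    (hn : σ ^ (n + 1) = 1) (τ : A ≃+* A) (Θ : RatFunc A ≃+* RatFunc A)
    (hΘ : ∀ a, Θ (RatFunc.C a) = RatFunc.C (τ a)) {k : ℕ}
    (hconj : ∀ z, Θ (σ z) = (σ ^ (k + 1)) (Θ z))
    (hτ : ∀ ξ : A, ξ ^ (n + 1) = 1 → τ (ξ + ξ⁻¹) = ξ + ξ⁻¹) :
    σ ^ k = 1 ∨ σ ^ (k + 2) = 1 := by
  obtain ⟨M, hdet, hM⟩ := exists_isMoebius σ
  -- The semilinear `Θ` is a Möbius transformation up to the action of `τ` on coefficients.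
  obtain ⟨N, hNdet, hN⟩ : ∃ N : Matrix (Fin 2) (Fin 2) A,
      N.det ≠ 0 ∧ IsMoebius N (Θ RatFunc.X) := by
    let t : RatFunc A ≃+* RatFunc A := IsFractionRing.ringEquivOfRingEquiv
      (K := RatFunc A) (L := RatFunc A) (Polynomial.mapEquiv τ)
    have htC : ∀ a, t (RatFunc.C a) = RatFunc.C (τ a) := by
      intro a
      rw [← RatFunc.algebraMap_C, IsFractionRing.ringEquivOfRingEquiv_algebraMap]
      simp
    have htX : t RatFunc.X = RatFunc.X := by
      rw [← RatFunc.algebraMap_X, IsFractionRing.ringEquivOfRingEquiv_algebraMap]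
      simp
    obtain ⟨N, hN, hN'⟩ := exists_isMoebius (A := A) (AlgEquiv.ofRingEquiv (f := t.symm.trans Θ) (by
      intro a
      have : t.symm (RatFunc.C a) = RatFunc.C (τ.symm a) := by
        rw [RingEquiv.symm_apply_eq, htC, RingEquiv.apply_symm_apply]
      change Θ (t.symm (RatFunc.C a)) = RatFunc.C a
      rw [this, hΘ, RingEquiv.apply_symm_apply]))
    refine ⟨N, hN, ?_⟩
    have hX : t.symm RatFunc.X = RatFunc.X := by rw [RingEquiv.symm_apply_eq, htX]
    change IsMoebius N (Θ (t.symm RatFunc.X)) at hN'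
    rwa [hX] at hN'
  obtain ⟨l, m, htr, hlm⟩ : ∃ l m : A, M.trace = l + m ∧ M.det = l * m := by
    obtain ⟨r, hr⟩ := IsAlgClosed.exists_pow_nat_eq (M.trace ^ 2 - 4 * M.det) zero_lt_two
    have h2 : (2 : A) ≠ 0 := two_ne_zero
    refine ⟨(M.trace + r) / 2, (M.trace - r) / 2, by field_simp; ring, ?_⟩
    field_simp
    linear_combination hr
  have hl : l ≠ 0 := by rintro rfl; simp [hlm] at hdet
  have hm : m ≠ 0 := by rintro rfl; simp [hlm] at hdet
  have hscal : ∀ q, σ ^ q = 1 → ∃ s : A, M ^ q = s • 1 := by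
    intro q hq
    have h1 := isMoebius_pow hM q
    rw [hq] at h1
    have h2 : IsMoebius (1 : Matrix (Fin 2) (Fin 2) A)
        ((1 : RatFunc A ≃ₐ[A] RatFunc A) RatFunc.X) :=
      by simp [IsMoebius]
    exact h2.unique h1 (by simp)
  obtain ⟨s, hs⟩ := hscal (n + 1) hn
  have hξ : (l / m) ^ (n + 1) = 1 := by
    have h1 := trace_pow_fin_two htr hlm (n + 1)
    have h2 := congrArg Matrix.det hs
    rw [det_pow, hlm, det_smul, det_one, Fintype.card_fin, mul_one, mul_pow] at h2
    rw [hs, trace_smul, trace_one, Fintype.card_fin, smul_eq_mul] at h1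
    rw [div_pow, div_eq_one_iff_eq (pow_ne_zero _ hm), ← sub_eq_zero,
      ← pow_eq_zero_iff two_ne_zero]
    push_cast at h1
    linear_combination (-(l ^ (n + 1) + m ^ (n + 1)) - s * 2) * h1 - 4 * h2
  have hone : ∀ q, (l / m) ^ q = 1 → σ ^ q = 1 := by
    intro q hq
    rw [div_pow, div_eq_one_iff_eq (pow_ne_zero _ hm)] at hq
    refine (isMoebius_pow hM q).eq_one (by rw [det_pow]; exact pow_ne_zero _ hdet)
      (eq_smul_one_of_pow_eq (p := l ^ q) (pow_ne_zero _ hl) ?_ ?_ (n := n) (s := s ^ q) ?_)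
    · rw [trace_pow_fin_two htr hlm, ← hq]; ring
    · rw [det_pow, hlm, mul_pow, ← hq]; ring
    · rw [← pow_mul, mul_comm, pow_mul, hs, smul_pow, one_pow]
  -- Compare the matrices of `Θ ∘ σ` and `σ ^ (k + 1) ∘ Θ`.
  have hinv : τ (l / m + (l / m)⁻¹ + 2) = (l / m) ^ (k + 1) + ((l / m) ^ (k + 1))⁻¹ + 2 := by
    have h1 : IsMoebius (M.map τ * N) (Θ (σ RatFunc.X)) :=
      IsMoebius.comp (θ := Θ.toRingHom) (τ := τ.toRingHom) hΘ hN hM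
    rw [hconj] at h1
    have h2 : IsMoebius (N * M ^ (k + 1)) ((σ ^ (k + 1)) (Θ RatFunc.X)) :=
      (isMoebius_pow hM (k + 1)).comp' hN
    obtain ⟨c, hc⟩ := h2.unique h1 (by
      rw [det_mul, det_pow]; exact mul_ne_zero hNdet (pow_ne_zero _ hdet))
    have hu : IsUnit N.det := hNdet.isUnit
    have hc' : M.map τ = c • (N * M ^ (k + 1) * N⁻¹) := by
      rw [← smul_mul_assoc, ← hc, Matrix.mul_assoc, Matrix.mul_nonsing_inv _ hu, mul_one]
    have htr' : τ (l + m) = c * (l ^ (k + 1) + m ^ (k + 1)) := by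
      rw [← htr, ← trace_pow_fin_two htr hlm]
      have h3 := congrArg Matrix.trace hc'
      rw [trace_smul, Matrix.trace_mul_cycle, Matrix.nonsing_inv_mul _ hu, one_mul,
        smul_eq_mul] at h3
      rw [← h3]
      simp [trace_fin_two]
    have hdet' : τ (l * m) = c ^ 2 * (l * m) ^ (k + 1) := by
      rw [← hlm]
      have h3 := congrArg Matrix.det hc'
      rw [det_smul, det_mul, det_mul, mul_right_comm, ← det_mul, Matrix.mul_nonsing_inv _ hu,
        det_one, one_mul, Fintype.card_fin, det_pow] at h3
      rw [← h3]
      simp [det_fin_two]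
    have hc0 : c ≠ 0 := by
      rintro rfl
      rw [zero_pow two_ne_zero, zero_mul, map_eq_zero] at hdet'
      exact (mul_ne_zero hl hm) hdet'
    have e1 : l / m + (l / m)⁻¹ + 2 = (l + m) ^ 2 / (l * m) := by field_simp; ring
    have e2 : (l / m) ^ (k + 1) + ((l / m) ^ (k + 1))⁻¹ + 2 =
        (l ^ (k + 1) + m ^ (k + 1)) ^ 2 / (l * m) ^ (k + 1) := by
      rw [div_pow, mul_pow]; field_simp; ring
    rw [e1, e2, map_div₀, map_pow, htr', hdet', mul_pow, mul_div_mul_left _ _ (pow_ne_zero 2 hc0)]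
  rw [map_add, hτ _ hξ, map_ofNat, add_left_inj] at hinv
  have hξ0 : l / m ≠ 0 := div_ne_zero hl hm
  set ξ := l / m
  have hfac : (ξ ^ k - 1) * (ξ ^ (k + 2) - 1) = 0 := by
    rw [pow_succ] at hinv
    field_simp at hinv
    linear_combination -hinv
  rcases mul_eq_zero.1 hfac with h | h
  · exact Or.inl (hone _ (sub_eq_zero.1 h))
  · exact Or.inr (hone _ (sub_eq_zero.1 h))

end Moebius

/-! ### The function field of a conic after extension of constants -/

section ConicField

lemma mem_of_adjoin_eq_top {K L : Type*} [Field K] [Field L] [Algebra K L] {s : Set L}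
    (h : IntermediateField.adjoin K s = ⊤) (S : Subfield L)
    (hK : ∀ k : K, algebraMap K L k ∈ S) (hs : ∀ z ∈ s, z ∈ S) (z : L) : z ∈ S := by
  let E : IntermediateField K L := S.toIntermediateField hK
  have hE : IntermediateField.adjoin K s ≤ E := IntermediateField.adjoin_le_iff.2 hs
  rw [h] at hE
  exact hE (show z ∈ ⊤ from trivial)

lemma ringHom_eq_of_adjoin_eq_top {K L T : Type*} [Field K] [Field L] [Algebra K L] [Field T]
    {s : Set L} (h : IntermediateField.adjoin K s = ⊤) (f g : L →+* T)
    (hK : ∀ k : K, f (algebraMap K L k) = g (algebraMap K L k)) (hs : ∀ z ∈ s, f z = g z) :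
    f = g :=
  RingHom.ext fun z ↦ mem_of_adjoin_eq_top h (f.eqLocusField g) hK hs z

lemma isAlgebraic_of_adjoin_eq_top {K L F T : Type*} [Field K] [Field L] [Algebra K L] [Field F]
    [Field T] [Algebra F T] {s : Set L} (h : IntermediateField.adjoin K s = ⊤) (f : L →+* T)
    (hK : ∀ k : K, IsAlgebraic F (f (algebraMap K L k))) (hs : ∀ z ∈ s, IsAlgebraic F (f z))
    (z : L) : IsAlgebraic F (f z) :=
  mem_algebraicClosure_iff.1 <| mem_of_adjoin_eq_top h ((algebraicClosure F T).toSubfield.comap f)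
    (fun k ↦ mem_algebraicClosure_iff.2 (hK k)) (fun z hz ↦ mem_algebraicClosure_iff.2 (hs z hz)) z

/-- The field `L` over `K` is generated by a generic point `(x, y)` of the affine conic
`x² - a y² = b`. -/
structure IsConicField (K : Type*) {L : Type*} [Field K] [Field L] [Algebra K L]
    (a b : K) (x y : L) : Prop where
  a_ne_zero : a ≠ 0
  b_ne_zero : b ≠ 0
  eq : x ^ 2 - algebraMap K L a * y ^ 2 = algebraMap K L b
  adjoin : IntermediateField.adjoin K {x, y} = ⊤
  not_isAlgebraic : ¬ Algebra.IsAlgebraic K L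

/-- An embedding of the function field `L` of the conic `x² - a y² = b` into `A(X)`, where `A` is an
extension of `K` with a square root `r` of `a`. The parameter `X` is `x - r y`, so that `A(X)` is
the function field of the conic over `A`. -/
structure IsRationalization {K L A : Type*} [Field K] [Field L] [Algebra K L] [Field A]
    [Algebra K A] (x y : L) (r : A) (j : L →+* RatFunc A) : Prop where
  commutes : ∀ k, j (algebraMap K L k) = RatFunc.C (algebraMap K A k)
  X_eq : j x - RatFunc.C r * j y = RatFunc.X

variable {K L A : Type*} [Field K] [Field L] [Algebra K L] [Field A] [Algebra K A]
  {a b : K} {x y : L} {r : A}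

lemma IsConicField.transcendental (h : IsConicField K a b x y) : Transcendental K y := by
  intro hy
  have hx : IsAlgebraic K x := by
    refine IsAlgebraic.of_pow (n := 2) zero_lt_two ?_
    have : x ^ 2 = algebraMap K L b + algebraMap K L a * y ^ 2 := by
      rw [← h.eq]; ring
    rw [this]
    exact (isAlgebraic_algebraMap b).add ((isAlgebraic_algebraMap a).mul (hy.pow 2))
  have halg : Algebra.IsAlgebraic K (IntermediateField.adjoin K {x, y}) := by
    refine IntermediateField.isAlgebraic_adjoin fun z hz ↦ ?_
    rcases hz with rfl | rfl
    · exact hx.isIntegral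
    · exact hy.isIntegral
  apply h.not_isAlgebraic
  rw [h.adjoin] at halg
  exact (IntermediateField.topEquiv (F := K) (E := L)).isAlgebraic

/-- Sending `y` to a transcendental element of an algebraically closed field over `A` extends to an
embedding of `L`, as `x` is algebraic over `K(y)`. The image lies in `A(u)` for `u = x - r y`. -/
lemma IsConicField.exists_isRationalization [CharZero K] (h : IsConicField K a b x y)
    (hr : r ^ 2 = algebraMap K A a) :
    ∃ j : L →+* RatFunc A, IsRationalization (K := K) x y r j := by
  have := charZero_of_injective_algebraMap (algebraMap K A).injective
  have hr0 : r ≠ 0 := by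
    rintro rfl
    rw [zero_pow two_ne_zero, eq_comm, map_eq_zero] at hr
    exact h.a_ne_zero hr
  let Ω := AlgebraicClosure (RatFunc A)
  let X' : Ω := algebraMap (RatFunc A) Ω RatFunc.X
  have hX'A : Transcendental A X' :=
    (transcendental_algebraMap_iff (algebraMap (RatFunc A) Ω).injective).2 RatFunc.transcendental_X
  have hX' : Transcendental K X' := hX'A.restrictScalars (algebraMap K A).injective
  let e : IntermediateField.adjoin K {y} ≃ₐ[K] IntermediateField.adjoin K {X'} :=
    (RatFunc.algEquivOfTranscendental y h.transcendental).symm.trans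
      (RatFunc.algEquivOfTranscendental X' hX')
  have hey : (e (IntermediateField.AdjoinSimple.gen K y) : Ω) = X' := by
    simp [e]
  let i : IntermediateField.adjoin K {y} →ₐ[K] Ω := (IntermediateField.val _).comp e.toAlgHom
  let : Algebra (IntermediateField.adjoin K {y}) Ω := i.toRingHom.toAlgebra
  have halg : Algebra.IsAlgebraic (IntermediateField.adjoin K {y}) L := by
    refine ⟨isAlgebraic_of_adjoin_eq_top h.adjoin (RingHom.id L) (fun k ↦ ?_) ?_⟩
    · exact isAlgebraic_algebraMap (algebraMap K (IntermediateField.adjoin K {y}) k)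
    · have hy : IsAlgebraic (IntermediateField.adjoin K {y}) y :=
        isAlgebraic_algebraMap (IntermediateField.AdjoinSimple.gen K y)
      have hx : IsAlgebraic (IntermediateField.adjoin K {y}) x := by
        refine IsAlgebraic.of_pow (n := 2) zero_lt_two ?_
        have : x ^ 2 = algebraMap K L b + algebraMap K L a * y ^ 2 := by
          rw [← h.eq]; ring
        rw [this]
        exact (isAlgebraic_algebraMap (algebraMap K (IntermediateField.adjoin K {y}) b)).add
          ((isAlgebraic_algebraMap (algebraMap K (IntermediateField.adjoin K {y}) a)).mul
            (hy.pow 2))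
      rintro z (rfl | rfl)
      · exact hx
      · exact hy
  let J : L →ₐ[IntermediateField.adjoin K {y}] Ω := IsAlgClosed.lift
  have hJK : ∀ k, J (algebraMap K L k) = algebraMap A Ω (algebraMap K A k) := by
    intro k
    rw [IsScalarTower.algebraMap_apply K (IntermediateField.adjoin K {y}) L, J.commutes]
    change i (algebraMap K _ k) = _
    rw [i.commutes, ← IsScalarTower.algebraMap_apply]
  have hJy : J y = X' := by
    rw [← hey]
    exact J.commutes (IntermediateField.AdjoinSimple.gen K y)
  have h2 : (2 : Ω) ≠ 0 := two_ne_zero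
  let r' : Ω := algebraMap A Ω r
  have hr' : r' ≠ 0 := by simpa [r'] using hr0
  let u : Ω := J x - r' * J y
  let w : Ω := J x + r' * J y
  have huw : u * w = algebraMap A Ω (algebraMap K A b) := by
    have h1 : r' ^ 2 = J (algebraMap K L a) := by rw [hJK, ← hr, map_pow]
    rw [← hJK, ← h.eq, map_sub, map_mul, map_pow, map_pow, ← h1]
    simp only [u, w]
    ring
  have hu0 : u ≠ 0 := by
    intro hu
    rw [hu, zero_mul, eq_comm, map_eq_zero, map_eq_zero] at huw
    exact h.b_ne_zero huw
  have hw : w = algebraMap A Ω (algebraMap K A b) / u := by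
    rw [eq_div_iff hu0, mul_comm, huw]
  have hJx : J x = (u + w) / 2 := by rw [eq_div_iff h2]; simp only [u, w]; ring
  have hJy' : J y = (w - u) / (2 * r') := by
    rw [eq_div_iff (mul_ne_zero h2 hr')]; simp only [u, w]; ring
  have hu : Transcendental A u := by
    intro hu
    apply hX'A
    have hr'alg : IsAlgebraic A r' := isAlgebraic_algebraMap r
    have h2alg : IsAlgebraic A (2 : Ω) := by
      rw [← map_ofNat (algebraMap A Ω) 2]; exact isAlgebraic_algebraMap _
    have hwalg : IsAlgebraic A w := by
      rw [hw, div_eq_mul_inv]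
      exact (isAlgebraic_algebraMap _).mul hu.inv
    rw [← hJy, hJy', div_eq_mul_inv]
    exact (hwalg.sub hu).mul ((h2alg.mul hr'alg).inv)
  let E := IntermediateField.adjoin A {u}
  have huE : u ∈ E := IntermediateField.mem_adjoin_simple_self A u
  have hwE : w ∈ E := by rw [hw]; exact E.div_mem (E.algebraMap_mem _) huE
  have hr'E : r' ∈ E := E.algebraMap_mem r
  have h2E : (2 : Ω) ∈ E := by
    rw [← map_ofNat (algebraMap A Ω) 2]; exact E.algebraMap_mem _
  have hrange : ∀ z, J z ∈ E := by
    refine mem_of_adjoin_eq_top h.adjoin (E.toSubfield.comap (J : L →+* Ω)) (fun k ↦ ?_) ?_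
    · change J (algebraMap K L k) ∈ E
      rw [hJK]
      exact E.algebraMap_mem _
    · rintro z (rfl | rfl)
      · change J z ∈ E
        rw [hJx]
        exact E.div_mem (E.add_mem huE hwE) h2E
      · change J z ∈ E
        rw [hJy']
        exact E.div_mem (E.sub_mem hwE huE) (E.mul_mem h2E hr'E)
  let e' : RatFunc A ≃ₐ[A] E := RatFunc.algEquivOfTranscendental u hu
  let J' : L →+* E := (J : L →+* Ω).codRestrict E.toSubfield hrange
  refine ⟨(e'.symm : E →+* RatFunc A).comp J', fun k ↦ ?_, ?_⟩
  · change e'.symm (J' (algebraMap K L k)) = _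
    rw [AlgEquiv.symm_apply_eq, ← RatFunc.algebraMap_eq_C, e'.commutes]
    exact Subtype.ext (hJK k)
  · change e'.symm (J' x) - RatFunc.C r * e'.symm (J' y) = _
    rw [← RatFunc.algebraMap_eq_C, ← e'.symm.commutes, ← map_mul, ← map_sub,
      AlgEquiv.symm_apply_eq]
    refine Subtype.ext ?_
    exact (RatFunc.algEquivOfTranscendental_X u hu).symm

namespace IsRationalization

variable {j : L →+* RatFunc A}

lemma ext {T : Type*} [Field T] (h : IsRationalization (K := K) x y r j) {f g : RatFunc A →+* T}
    (hC : ∀ a, f (RatFunc.C a) = g (RatFunc.C a)) (hj : ∀ z, f (j z) = g (j z)) : f = g := by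
  refine ringHom_eq_of_adjoin_eq_top (K := A) RatFunc.adjoin_X f g hC ?_
  rintro z rfl
  rw [← h.X_eq, map_sub, map_sub, map_mul, map_mul, hC, hj, hj]

/-- An automorphism of `L` that preserves `K`, together with an extension to `A` of its restriction
to `K`, extends to an endomorphism of `A(X)`. -/
lemma exists_ringHom [CharZero K] (hc : IsConicField K a b x y) (hr : r ^ 2 = algebraMap K A a)
    (h : IsRationalization (K := K) x y r j) (g : L ≃+* L) (β : K ≃+* K) (τ : A ≃+* A)
    (hg : ∀ k, g (algebraMap K L k) = algebraMap K L (β k))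
    (hτ : ∀ k, τ (algebraMap K A k) = algebraMap K A (β k)) :
    ∃ θ : RatFunc A →+* RatFunc A, (∀ c, θ (RatFunc.C c) = RatFunc.C (τ c)) ∧
      ∀ z, θ (j z) = j (g z) := by
  have := charZero_of_injective_algebraMap (algebraMap K A).injective
  have hr0 : r ≠ 0 := by
    rintro rfl
    rw [zero_pow two_ne_zero, eq_comm, map_eq_zero] at hr
    exact hc.a_ne_zero hr
  have h2 : (2 : RatFunc A) ≠ 0 := two_ne_zero
  let s : RatFunc A := RatFunc.C (τ r)
  have hs : s ≠ 0 := by simpa [s] using hr0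
  let v := j (g x) - s * j (g y)
  let w := j (g x) + s * j (g y)
  have hvw : v * w = RatFunc.C (algebraMap K A (β b)) := by
    have h1 : s ^ 2 = j (g (algebraMap K L a)) := by
      rw [hg, h.commutes, ← hτ, ← hr, map_pow, map_pow]
    rw [← h.commutes, ← hg, ← hc.eq, map_sub, map_sub, map_mul, map_mul, map_pow, map_pow, map_pow,
      map_pow, ← h1]
    simp only [v, w]
    ring
  have hv0 : v ≠ 0 := by
    intro hv
    rw [hv, zero_mul, eq_comm, map_eq_zero, map_eq_zero, map_eq_zero] at hvw
    exact hc.b_ne_zero hvw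
  have hw : w = RatFunc.C (algebraMap K A (β b)) / v := by
    rw [eq_div_iff hv0, mul_comm, hvw]
  have hjx : j (g x) = (v + w) / 2 := by simp only [v, w]; field_simp; ring
  have hjy : j (g y) = (w - v) / (2 * s) := by simp only [v, w]; field_simp; ring
  have hCalg : ∀ c : A, IsAlgebraic A (RatFunc.C c) := fun c ↦ by
    rw [← RatFunc.algebraMap_eq_C]
    exact isAlgebraic_algebraMap c
  -- If `v` were algebraic over `A`, then `j (g L) = j L` would be, and hence `X`.
  have hv : Transcendental A v := by
    intro hv
    have hwalg : IsAlgebraic A w := by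
      rw [hw, div_eq_mul_inv]
      exact (hCalg _).mul hv.inv
    have h2alg : IsAlgebraic A (2 : RatFunc A) := by
      rw [← map_ofNat RatFunc.C 2]; exact hCalg 2
    have hall : ∀ z, IsAlgebraic A (j (g z)) := by
      refine isAlgebraic_of_adjoin_eq_top hc.adjoin (j.comp (g : L →+* L)) (fun k ↦ ?_) ?_
      · change IsAlgebraic A (j (g (algebraMap K L k)))
        rw [hg, h.commutes]
        exact hCalg _
      · rintro z (rfl | rfl)
        · change IsAlgebraic A (j (g z))
          rw [hjx, div_eq_mul_inv]
          exact (hv.add hwalg).mul h2alg.inv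
        · change IsAlgebraic A (j (g z))
          rw [hjy, div_eq_mul_inv]
          exact (hwalg.sub hv).mul (h2alg.mul (hCalg _)).inv
    apply RatFunc.transcendental_X (K := A)
    rw [← h.X_eq]
    have hx := hall (g.symm x)
    have hy := hall (g.symm y)
    rw [RingEquiv.apply_symm_apply] at hx hy
    exact hx.sub ((hCalg r).mul hy)
  let φ : Polynomial A →+* RatFunc A := Polynomial.eval₂RingHom (RatFunc.C.comp (τ : A →+* A)) v
  have hφ : Function.Injective φ := by
    rw [injective_iff_map_eq_zero]
    intro p hp
    have h1 : Polynomial.aeval v (p.map (τ : A →+* A)) = 0 := by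
      rw [Polynomial.aeval_def, Polynomial.eval₂_map, RatFunc.algebraMap_eq_C]
      exact hp
    have h3 := (transcendental_iff.1 hv) _ h1
    rwa [Polynomial.map_eq_zero_iff τ.injective] at h3
  let θ : RatFunc A →+* RatFunc A := IsFractionRing.lift hφ
  have hθC : ∀ c, θ (RatFunc.C c) = RatFunc.C (τ c) := by
    intro c
    rw [← RatFunc.algebraMap_C]
    exact (IsFractionRing.lift_algebraMap hφ _).trans (by simp [φ])
  have hθX : θ RatFunc.X = v := by
    rw [← RatFunc.algebraMap_X]
    exact (IsFractionRing.lift_algebraMap hφ _).trans (by simp [φ])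
  -- The coordinates `x` and `y` are determined by `X = x - r y` and `b / X = x + r y`.
  have hwX : j x + RatFunc.C r * j y = RatFunc.C (algebraMap K A b) / RatFunc.X := by
    rw [eq_div_iff RatFunc.X_ne_zero, ← h.X_eq, ← h.commutes, ← hc.eq, map_sub, map_mul, map_pow,
      map_pow, h.commutes, ← hr, map_pow]
    ring
  have hθw : θ (j x + RatFunc.C r * j y) = w := by
    rw [hwX, map_div₀, hθC, hθX, hτ, hw]
  have hθv : θ (j x - RatFunc.C r * j y) = v := by rw [h.X_eq, hθX]
  rw [map_add, map_mul, hθC] at hθw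
  rw [map_sub, map_mul, hθC] at hθv
  refine ⟨θ, hθC, ?_⟩
  have hcomp : θ.comp j = j.comp (g : L →+* L) := by
    refine ringHom_eq_of_adjoin_eq_top hc.adjoin _ _ (fun k ↦ ?_) ?_
    · change θ (j (algebraMap K L k)) = j (g (algebraMap K L k))
      rw [hg, h.commutes, h.commutes, hθC, hτ]
    · rintro z (rfl | rfl)
      · change θ (j z) = j (g z)
        rw [hjx, ← hθw, ← hθv]
        field_simp
        ring
      · change θ (j z) = j (g z)
        rw [hjy, ← hθw, ← hθv]
        field_simp
        ring
  exact fun z ↦ RingHom.congr_fun hcomp z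

lemma exists_ringEquiv [CharZero K] (hc : IsConicField K a b x y) (hr : r ^ 2 = algebraMap K A a)
    (h : IsRationalization (K := K) x y r j) (g : L ≃+* L) (β : K ≃+* K) (τ : A ≃+* A)
    (hg : ∀ k, g (algebraMap K L k) = algebraMap K L (β k))
    (hτ : ∀ k, τ (algebraMap K A k) = algebraMap K A (β k)) :
    ∃ Θ : RatFunc A ≃+* RatFunc A, (∀ c, Θ (RatFunc.C c) = RatFunc.C (τ c)) ∧
      ∀ z, Θ (j z) = j (g z) := by
  obtain ⟨θ, hθ, hθj⟩ := h.exists_ringHom hc hr g β τ hg hτ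
  obtain ⟨θ', hθ', hθj'⟩ := h.exists_ringHom hc hr g.symm β.symm τ.symm
    (fun k ↦ by rw [RingEquiv.symm_apply_eq, hg, RingEquiv.apply_symm_apply])
    (fun k ↦ by rw [RingEquiv.symm_apply_eq, hτ, RingEquiv.apply_symm_apply])
  refine ⟨RingEquiv.ofRingHom θ θ' ?_ ?_, hθ, hθj⟩
  · exact h.ext (fun c ↦ by simp [hθ, hθ']) (fun z ↦ by simp [hθj, hθj'])
  · exact h.ext (fun c ↦ by simp [hθ, hθ']) (fun z ↦ by simp [hθj, hθj'])

/-- A group of automorphisms of `L` over `K` acts on `A(X)` over `A`. -/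
lemma exists_monoidHom [CharZero K] (hc : IsConicField K a b x y) (hr : r ^ 2 = algebraMap K A a)
    (h : IsRationalization (K := K) x y r j) {N : Type*} [Group N] (ρ : N →* (L ≃+* L))
    (hρ : ∀ n k, ρ n (algebraMap K L k) = algebraMap K L k) :
    ∃ ρ' : N →* (RatFunc A ≃ₐ[A] RatFunc A), ∀ n z, ρ' n (j z) = j (ρ n z) := by
  choose θ hθ hθj using fun n ↦ h.exists_ringEquiv hc hr (ρ n) (RingEquiv.refl K)
    (RingEquiv.refl A) (hρ n) (fun k ↦ rfl)
  let Θ : N → (RatFunc A ≃ₐ[A] RatFunc A) := fun n ↦ AlgEquiv.ofRingEquiv (f := θ n) (hθ n)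
  have hΘ : ∀ n z, Θ n z = θ n z := fun n z ↦ rfl
  have hext : ∀ f g : RatFunc A ≃ₐ[A] RatFunc A, (∀ z, f (j z) = g (j z)) → f = g := by
    intro f g hfg
    have := h.ext (f := (f : RatFunc A →+* RatFunc A)) (g := (g : RatFunc A →+* RatFunc A))
      (fun c ↦ by
        rw [← RatFunc.algebraMap_eq_C]
        exact (f.commutes c).trans (g.commutes c).symm) hfg
    exact AlgEquiv.ext fun z ↦ RingHom.congr_fun this z
  refine ⟨⟨⟨Θ, hext _ _ fun z ↦ ?_⟩, fun n m ↦ hext _ _ fun z ↦ ?_⟩, fun n z ↦ ?_⟩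
  · rw [hΘ, hθj, map_one]
    rfl
  · rw [AlgEquiv.mul_apply, hΘ, hΘ, hΘ, hθj, hθj, hθj, map_mul]
    rfl
  · exact hθj n z

end IsRationalization

end ConicField

/-! ### Finite groups acting on the function field of a conic over a real rational field -/

section FieldAction

variable {R : Type*} [Field R] [LinearOrder R] [IsStrictOrderedRing R]

lemma nonempty_algEquiv_real {K : Type*} [Field K] [Algebra ℝ K] [Algebra.IsAlgebraic ℝ K]
    (ι : K →+* R) : Nonempty (K ≃ₐ[ℝ] ℝ) := by
  refine (Real.nonempty_algEquiv_or K).resolve_right ?_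
  rintro ⟨e⟩
  have h : ι (e.symm Complex.I) * ι (e.symm Complex.I) = -1 := by
    rw [← map_mul, ← map_mul, Complex.I_mul_I, map_neg, map_neg, map_one, map_one]
  nlinarith [mul_self_nonneg (ι (e.symm Complex.I))]

/-- A finite group of automorphisms of `ℝ(t)` over `ℝ` has a cyclic subgroup of index at most two.
If `t` is algebraic, then `ℝ(t) = ℝ`, as the field is formally real. -/
lemma exists_isCyclic_of_adjoin_simple {K : Type*} [Field K] [Algebra ℝ K] (t : K)
    (ht : IntermediateField.adjoin ℝ {t} = ⊤) (ι : K →+* R) {H : Type*} [Group H] [Finite H]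
    (ρ : H →* (K ≃ₐ[ℝ] K)) (hρ : Function.Injective ρ) :
    ∃ C : Subgroup H, IsCyclic C ∧ ∀ a b, a ∉ C → b ∉ C → a * b ∈ C := by
  by_cases htr : Transcendental ℝ t
  · let e : RatFunc ℝ ≃ₐ[ℝ] K := (RatFunc.algEquivOfTranscendental t htr).trans
      ((IntermediateField.equivOfEq ht).trans IntermediateField.topEquiv)
    obtain ⟨C, hC, hmul, -⟩ := exists_isCyclic_of_ratFunc
      ((AlgEquiv.autCongr e.symm).toMonoidHom.comp ρ)
      ((AlgEquiv.autCongr e.symm).injective.comp hρ)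
    exact ⟨C, hC, hmul⟩
  · have halg : Algebra.IsAlgebraic ℝ K := by
      have h1 : Algebra.IsAlgebraic ℝ (IntermediateField.adjoin ℝ {t}) :=
        IntermediateField.isAlgebraic_adjoin_simple (not_not.1 htr : IsAlgebraic ℝ t).isIntegral
      rw [ht] at h1
      exact (IntermediateField.topEquiv (F := ℝ) (E := K)).isAlgebraic
    obtain ⟨e⟩ := nonempty_algEquiv_real ι
    have hsub : ∀ a b : H, a = b := by
      intro a b
      refine hρ ((AlgEquiv.autCongr e).injective (AlgEquiv.ext fun z ↦ ?_))
      exact ((AlgEquiv.autCongr e (ρ a)).commutes z).trans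
        ((AlgEquiv.autCongr e (ρ b)).commutes z).symm
    exact ⟨⊥, inferInstance, fun a b ha ↦ absurd (hsub a 1) (by simpa using ha)⟩

/-- The sum of a root of unity and its inverse is real, also in an algebraically closed field of
functions over `ℝ`, because all roots of unity come from `ℂ`. -/
lemma exists_real_eq_add_inv {A : Type*} [Field A] [IsAlgClosed A] [Algebra ℝ A] {ξ : A} {n : ℕ}
    (h : ξ ^ (n + 1) = 1) : ∃ c : ℝ, ξ + ξ⁻¹ = algebraMap ℝ A c := by
  let φ : ℂ →ₐ[ℝ] A := IsAlgClosed.lift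
  have hprim := Complex.isPrimitiveRoot_exp (n + 1) n.succ_ne_zero
  obtain ⟨i, -, hi⟩ := (hprim.map_of_injective φ.injective).eq_pow_of_pow_eq_one h
  set z := Complex.exp (2 * Real.pi * Complex.I / (n + 1 : ℕ)) ^ i with hz
  have hz1 : z ^ (n + 1) = 1 := by rw [hz, pow_right_comm, hprim.pow_eq_one, one_pow]
  have hnorm : ‖z‖ = 1 := Complex.norm_eq_one_of_pow_eq_one hz1 n.succ_ne_zero
  refine ⟨2 * z.re, ?_⟩
  rw [← hi, ← map_pow, ← hz, ← map_inv₀, ← map_add, Complex.inv_eq_conj hnorm, Complex.add_conj]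
  exact φ.commutes _

/-- One of `a` and `b` is non-negative in an ordered field that contains `L`, and
`x² - a y² = b` is equivalent to `(x / y)² - b (1 / y)² = a`. -/
lemma IsConicField.exists_nonneg {K L : Type*} [Field K] [Field L] [Algebra K L] {a b : K} {x y : L}
    (h : IsConicField K a b x y) (ι : L →+* R) :
    ∃ (a' b' : K) (x' y' : L), IsConicField K a' b' x' y' ∧ 0 ≤ ι (algebraMap K L a') := by
  by_cases ha : 0 ≤ ι (algebraMap K L a)
  · exact ⟨a, b, x, y, h, ha⟩
  · have hy : y ≠ 0 := by
      rintro rfl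
      exact h.transcendental isAlgebraic_zero
    refine ⟨b, a, x / y, y⁻¹, ⟨h.b_ne_zero, h.a_ne_zero, ?_, ?_, h.not_isAlgebraic⟩, ?_⟩
    · rw [← h.eq]
      field_simp
      ring
    · rw [eq_top_iff, ← h.adjoin, IntermediateField.adjoin_le_iff]
      have h1 : y⁻¹ ∈ IntermediateField.adjoin K {x / y, y⁻¹} :=
        IntermediateField.subset_adjoin _ _ (by simp)
      have h2 : x / y ∈ IntermediateField.adjoin K {x / y, y⁻¹} :=
        IntermediateField.subset_adjoin _ _ (by simp)
      have h3 : y ∈ IntermediateField.adjoin K {x / y, y⁻¹} := by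
        simpa using inv_mem h1
      rintro z (rfl | rfl)
      · have := mul_mem h2 h3
        rwa [div_mul_cancel₀ _ hy] at this
      · exact h3
    · rw [← h.eq, map_sub, map_mul, map_pow, map_pow]
      have h1 := sq_nonneg (ι x)
      have h2 := mul_nonneg (neg_nonneg.2 (le_of_not_ge ha)) (sq_nonneg (ι y))
      linarith

variable {L : Type*} [Field L] [Algebra ℝ L] {G : Type*} [Group G]

/-- The action on a stable subfield. -/
noncomputable def restrictHom (ρ : G →* (L ≃ₐ[ℝ] L)) (K : IntermediateField ℝ L)
    (hK : ∀ g, ∀ z ∈ K, ρ g z ∈ K) : G →* (K ≃ₐ[ℝ] K) where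
  toFun g := AlgEquiv.ofAlgHom
    (((ρ g : L →ₐ[ℝ] L).comp K.val).codRestrict K.toSubalgebra fun z ↦ hK g z z.2)
    (((ρ g⁻¹ : L →ₐ[ℝ] L).comp K.val).codRestrict K.toSubalgebra fun z ↦ hK g⁻¹ z z.2)
    (AlgHom.ext fun z ↦ Subtype.ext (by
      change ρ g (ρ g⁻¹ z) = z
      rw [← AlgEquiv.mul_apply, ← map_mul, mul_inv_cancel, map_one, AlgEquiv.one_apply]))
    (AlgHom.ext fun z ↦ Subtype.ext (by
      change ρ g⁻¹ (ρ g z) = z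
      rw [← AlgEquiv.mul_apply, ← map_mul, inv_mul_cancel, map_one, AlgEquiv.one_apply]))
  map_one' := AlgEquiv.ext fun z ↦ Subtype.ext (by
    change ρ 1 z = z
    rw [map_one, AlgEquiv.one_apply])
  map_mul' g h := AlgEquiv.ext fun z ↦ Subtype.ext (by
    change ρ (g * h) z = ρ g (ρ h z)
    rw [map_mul, AlgEquiv.mul_apply])

/-- The automorphisms in `G` of the conic over `K` act on its function field over an extension `A`
of `K`. -/
lemma exists_ker_monoidHom (ρ : G →* (L ≃ₐ[ℝ] L)) (hρ : Function.Injective ρ)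
    (K : IntermediateField ℝ L) (hK : ∀ g, ∀ z ∈ K, ρ g z ∈ K) {a b : K} {x y : L}
    (hc : IsConicField K a b x y) {A : Type*} [Field A] [Algebra K A] {r : A}
    (hr : r ^ 2 = algebraMap K A a) {j : L →+* RatFunc A}
    (hj : IsRationalization (K := K) x y r j) :
    ∃ ρ' : (restrictHom ρ K hK).ker →* (RatFunc A ≃ₐ[A] RatFunc A), Function.Injective ρ' ∧
      ∀ n z, ρ' n (j z) = j (ρ n z) := by
  let ρ₀ : (restrictHom ρ K hK).ker →* (L ≃+* L) :=
    { toFun := fun n ↦ (ρ n : L ≃+* L)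
      map_one' := by rw [OneMemClass.coe_one, map_one]; rfl
      map_mul' := fun m n ↦ by rw [Subgroup.coe_mul, map_mul]; rfl }
  obtain ⟨ρ', hρ'⟩ := hj.exists_monoidHom hc hr ρ₀ (fun n k ↦
    congrArg Subtype.val (AlgEquiv.congr_fun (MonoidHom.mem_ker.1 n.2) k))
  refine ⟨ρ', ?_, hρ'⟩
  rw [injective_iff_map_eq_one]
  intro n hn
  refine Subtype.ext (hρ (AlgEquiv.ext fun z ↦ j.injective ?_))
  have := hρ' n z
  rw [hn, AlgEquiv.one_apply] at this
  rw [OneMemClass.coe_one, map_one, AlgEquiv.one_apply]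
  exact this.symm

/-- Conjugation by an element of `G` raises no automorphism of the conic over `K` to a power other
than `±1`. -/
lemma conj_eq_or_eq_inv [Finite G] (ρ : G →* (L ≃ₐ[ℝ] L)) (hρ : Function.Injective ρ)
    (K : IntermediateField ℝ L) (hK : ∀ g, ∀ z ∈ K, ρ g z ∈ K) {a b : K} {x y : L}
    (hc : IsConicField K a b x y) (s : G) (hs : s ∈ (restrictHom ρ K hK).ker) (g : G)
    (hg : g * s * g⁻¹ ∈ Subgroup.zpowers s) : g * s * g⁻¹ = s ∨ g * s * g⁻¹ = s⁻¹ := by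
  obtain ⟨r, hr⟩ := IsAlgClosed.exists_pow_nat_eq (algebraMap K (AlgebraicClosure K) a) zero_lt_two
  obtain ⟨j, hj⟩ := hc.exists_isRationalization hr
  obtain ⟨ρ', hinj, hρ'⟩ := exists_ker_monoidHom ρ hρ K hK hc hr hj
  let τ : AlgebraicClosure K ≃+* AlgebraicClosure K :=
    IsAlgClosure.equivOfEquiv _ _ (restrictHom ρ K hK g : K ≃+* K)
  have hτ : ∀ k, τ (algebraMap K _ k) = algebraMap K _ (restrictHom ρ K hK g k) := fun k ↦
    IsAlgClosure.equivOfEquiv_algebraMap _ _ (restrictHom ρ K hK g : K ≃+* K) k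
  obtain ⟨Θ, hΘ, hΘj⟩ := hj.exists_ringEquiv hc hr (ρ g : L ≃+* L) (restrictHom ρ K hK g : K ≃+* K)
    τ (fun k ↦ rfl) hτ
  obtain ⟨n, hn⟩ : ∃ n, orderOf s = n + 1 := Nat.exists_eq_succ_of_ne_zero (orderOf_pos s).ne'
  obtain ⟨k, hk⟩ : ∃ k, s ^ (k + 1) = g * s * g⁻¹ := by
    rw [← mem_powers_iff_mem_zpowers] at hg
    obtain ⟨m, hm⟩ := Submonoid.mem_powers_iff _ _ |>.1 hg
    refine ⟨m + n, ?_⟩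
    rw [add_assoc, ← hn, pow_add, hm, pow_orderOf_eq_one, mul_one]
  have hσn : ρ' ⟨s, hs⟩ ^ (n + 1) = 1 := by
    have : (⟨s, hs⟩ : (restrictHom ρ K hK).ker) ^ (n + 1) = 1 :=
      Subtype.ext (by rw [← hn]; exact pow_orderOf_eq_one s)
    rw [← map_pow, this, map_one]
  have hconj : ∀ z, Θ (ρ' ⟨s, hs⟩ z) = (ρ' ⟨s, hs⟩ ^ (k + 1)) (Θ z) := by
    have hC : ∀ m c, ρ' m (RatFunc.C c) = RatFunc.C c := fun m c ↦ by
      rw [← RatFunc.algebraMap_eq_C]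
      exact (ρ' m).commutes c
    have := hj.ext (f := Θ.toRingHom.comp (ρ' ⟨s, hs⟩).toRingEquiv.toRingHom)
      (g := (ρ' (⟨s, hs⟩ ^ (k + 1))).toRingEquiv.toRingHom.comp Θ.toRingHom)
      (fun c ↦ ?_) (fun z ↦ ?_)
    · intro z
      rw [← map_pow]
      exact RingHom.congr_fun this z
    · change Θ (ρ' _ (RatFunc.C c)) = ρ' _ (Θ (RatFunc.C c))
      rw [hC, hΘ, hC]
    · change Θ (ρ' _ (j z)) = ρ' _ (Θ (j z))
      rw [hρ', hΘj, hΘj, hρ']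
      congr 1
      change ρ g (ρ s z) = ρ (s ^ (k + 1)) (ρ g z)
      rw [hk, ← AlgEquiv.mul_apply, ← AlgEquiv.mul_apply, ← map_mul, ← map_mul]
      simp
  have hreal : ∀ ξ : AlgebraicClosure K, ξ ^ (n + 1) = 1 → τ (ξ + ξ⁻¹) = ξ + ξ⁻¹ := by
    intro ξ hξ
    obtain ⟨c, hc⟩ := exists_real_eq_add_inv hξ
    rw [hc, IsScalarTower.algebraMap_apply ℝ K (AlgebraicClosure K), hτ, AlgEquiv.commutes]
  rcases pow_eq_one_or_of_conj (ρ' ⟨s, hs⟩) hσn τ Θ hΘ hconj hreal with h | h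
  · left
    rw [← map_pow] at h
    have := congrArg Subtype.val (hinj (h.trans (map_one ρ').symm))
    rw [← hk, pow_succ]
    change s ^ k = 1 at this
    rw [this, one_mul]
  · right
    rw [← map_pow] at h
    have := congrArg Subtype.val (hinj (h.trans (map_one ρ').symm))
    change s ^ (k + 2) = 1 at this
    rw [← hk, eq_inv_iff_mul_eq_one, ← pow_succ, this]

/-- A finite group of automorphisms of `L` that preserve `K = ℝ(t)`, where `L` is either `K` or the
function field of a smooth conic over `K`. The element `t` may be algebraic over `ℝ`. -/
theorem exists_normal_abelian_of_isConicField [Finite G]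
    (ρ : G →* (L ≃ₐ[ℝ] L)) (hρ : Function.Injective ρ)
    (K : IntermediateField ℝ L) (hK : ∀ g, ∀ z ∈ K, ρ g z ∈ K)
    (t : L) (ht : K = IntermediateField.adjoin ℝ {t})
    (ι : L →+* R) (hsqrt : ∀ z : R, 0 ≤ z → ∃ w, w ^ 2 = z)
    (hL : K = ⊤ ∨ ∃ (a b : K) (x y : L), IsConicField K a b x y) :
    ∃ A : Subgroup G, A.Normal ∧ IsMulCommutative A ∧ A.index ≤ 8 := by
  set f := restrictHom ρ K hK with hf
  obtain ⟨Z, hZ, hZi⟩ : ∃ Z : Subgroup (K ≃ₐ[ℝ] K), IsCyclic Z ∧ (Z.comap f).index ≤ 2 := by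
    have htK : t ∈ K := ht ▸ IntermediateField.mem_adjoin_simple_self ℝ t
    have htop : IntermediateField.adjoin ℝ {(⟨t, htK⟩ : K)} = ⊤ := by
      apply IntermediateField.map_injective K.val
      rw [IntermediateField.adjoin_map, Set.image_singleton, ← AlgHom.fieldRange_eq_map,
        IntermediateField.fieldRange_val]
      exact ht.symm
    have : Finite f.range := Set.finite_range f
    obtain ⟨C, hC, hmul⟩ := exists_isCyclic_of_adjoin_simple _ htop (ι.comp (algebraMap K L))
      f.range.subtype f.range.subtype_injective
    refine ⟨C.map f.range.subtype, ?_, index_le_two_of_mul_mem fun a b ha hb ↦ ?_⟩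
    · exact isCyclic_of_surjective (C.equivMapOfInjective _ f.range.subtype_injective)
        (MulEquiv.surjective _)
    · have hmem : ∀ c : G, c ∈ (C.map f.range.subtype).comap f ↔ f.rangeRestrict c ∈ C := by
        intro c
        rw [Subgroup.mem_comap, Subgroup.mem_map]
        constructor
        · rintro ⟨z, hz, hzc⟩
          have : z = f.rangeRestrict c := Subtype.ext hzc
          rwa [← this]
        · exact fun h ↦ ⟨_, h, rfl⟩
      rw [hmem] at ha hb ⊢
      rw [map_mul]
      exact hmul _ _ ha hb
  rcases hL with rfl | ⟨a₀, b₀, x₀, y₀, hc₀⟩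
  · have hker : ∀ n ∈ f.ker, n = 1 := by
      intro n hn
      refine hρ (AlgEquiv.ext fun z ↦ ?_)
      rw [map_one, AlgEquiv.one_apply]
      exact congrArg Subtype.val (AlgEquiv.congr_fun (MonoidHom.mem_ker.1 hn) ⟨z, trivial⟩)
    refine exists_normal_abelian_index_le_eight f Z hZi ⊥ bot_le (fun a ha b _ h ↦ ?_)
      (fun n hn h ↦ ?_) (fun s hs g _ ↦ ?_)
    · exact absurd (hker a ha) (by simpa using h)
    · exact absurd (hker n hn) (by simpa using h)
    · simp [hker s hs]
  · obtain ⟨a, b, x, y, hc, ha⟩ := hc₀.exists_nonneg ι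
    let : Algebra K R := (ι.comp (algebraMap K L)).toAlgebra
    obtain ⟨r, hr⟩ := hsqrt _ ha
    have hr' : r ^ 2 = algebraMap K R a := hr
    obtain ⟨j, hj⟩ := hc.exists_isRationalization hr'
    obtain ⟨ρ', hinj, -⟩ := exists_ker_monoidHom ρ hρ K hK hc hr' hj
    obtain ⟨C, hC, hmul, hsq⟩ := exists_isCyclic_of_ratFunc ρ' hinj
    have hmem : ∀ n (hn : n ∈ f.ker), n ∈ C.map f.ker.subtype ↔ (⟨n, hn⟩ : f.ker) ∈ C := by
      intro n hn
      rw [Subgroup.mem_map]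
      constructor
      · rintro ⟨z, hz, rfl⟩
        exact hz
      · exact fun h ↦ ⟨_, h, rfl⟩
    have : IsCyclic (C.map f.ker.subtype) :=
      isCyclic_of_surjective (C.equivMapOfInjective _ f.ker.subtype_injective)
        (MulEquiv.surjective _)
    -- Over `R` the kernel is dihedral; its conjugation action is controlled over the algebraic
    -- closure of `K` instead, since the action of `G` on `K` need not extend to `R`.
    refine exists_normal_abelian_index_le_eight f Z hZi (C.map f.ker.subtype)
      (Subgroup.map_subtype_le C) (fun a ha b hb ha' hb' ↦ ?_) (fun n hn h ↦ ?_)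
      (fun s hs g hg ↦ conj_eq_or_eq_inv ρ hρ K hK hc s hs g hg)
    · rw [hmem a ha] at ha'
      rw [hmem b hb] at hb'
      rw [hmem _ (Subgroup.mul_mem _ ha hb)]
      exact hmul _ _ ha' hb'
    · rw [hmem n hn] at h
      exact congrArg Subtype.val (hsq _ h)

end FieldAction

universe v

/-! ### Orderings and curves of the field of rational functions in several variables -/

section MvRationalFunctions

variable (n : Type v)

/-- The field `ℝ(xᵢ : i ∈ n)` embeds in an ordered field in which positive elements are squares: the
ultraproduct of copies of `ℝ` indexed by the points of affine space, along an ultrafilter that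
contains all nonempty Zariski open sets. -/
lemma exists_orderedField_fractionRing :
    ∃ (R : Type v) (_ : Field R) (_ : LinearOrder R) (_ : IsStrictOrderedRing R),
      (∀ z : R, 0 ≤ z → ∃ w, w ^ 2 = z) ∧
        Nonempty (FractionRing (MvPolynomial n ℝ) →+* R) := by
  let F : Filter (n → ℝ) := ⨅ p : {p : MvPolynomial n ℝ // p ≠ 0},
    Filter.principal {x | MvPolynomial.eval x p.1 ≠ 0}
  have hF : F.NeBot := by
    have : Nonempty {p : MvPolynomial n ℝ // p ≠ 0} := ⟨⟨1, one_ne_zero⟩⟩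
    refine Filter.iInf_neBot_of_directed ?_ ?_
    · rintro ⟨p, hp⟩ ⟨q, hq⟩
      refine ⟨⟨p * q, mul_ne_zero hp hq⟩, ?_, ?_⟩
      · refine Filter.principal_mono.2 fun x hx ↦ ?_
        rw [Set.mem_ofPred_eq, map_mul] at hx
        exact left_ne_zero_of_mul hx
      · refine Filter.principal_mono.2 fun x hx ↦ ?_
        rw [Set.mem_ofPred_eq, map_mul] at hx
        exact right_ne_zero_of_mul hx
    · rintro ⟨p, hp⟩
      rw [Filter.principal_neBot_iff]
      by_contra hne
      refine hp (MvPolynomial.funext fun x ↦ ?_)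
      rw [map_zero]
      by_contra hx
      exact hne ⟨x, hx⟩
  let U : Ultrafilter (n → ℝ) := Ultrafilter.of F
  refine ⟨(U : Filter (n → ℝ)).Germ ℝ, inferInstance, inferInstance, inferInstance, ?_, ⟨?_⟩⟩
  · intro z
    induction z using Filter.Germ.inductionOn with
    | _ f =>
      intro hz
      refine ⟨((fun x ↦ √(f x) : (n → ℝ) → ℝ) : (U : Filter (n → ℝ)).Germ ℝ), ?_⟩
      have hz' : ∀ᶠ x in (U : Filter (n → ℝ)), 0 ≤ f x := Filter.Germ.coe_le.1 hz
      rw [← Filter.Germ.coe_pow]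
      refine Filter.Germ.coe_eq.2 (hz'.mono fun x hx ↦ ?_)
      exact Real.sq_sqrt hx
  · let ev : MvPolynomial n ℝ →+* (n → ℝ) → ℝ := RingHom.pi fun x ↦ MvPolynomial.eval x
    have hinj : Function.Injective ((Filter.Germ.coeRingHom (U : Filter (n → ℝ))).comp ev) := by
      rw [injective_iff_map_eq_zero]
      intro p hp
      by_contra hp0
      have h1 : ∀ᶠ x in (U : Filter (n → ℝ)), MvPolynomial.eval x p = 0 := Filter.Germ.coe_eq.1 hp
      have h2 : ∀ᶠ x in (U : Filter (n → ℝ)), MvPolynomial.eval x p ≠ 0 :=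
        Ultrafilter.of_le F (Filter.mem_iInf_of_mem ⟨p, hp0⟩ (Filter.mem_principal_self _))
      obtain ⟨x, hx1, hx2⟩ := (h1.and h2).exists
      exact hx2 hx1
    exact IsFractionRing.lift hinj

variable {n}

/-- A finite extension of `ℝ(t)` that embeds in `ℝ(xᵢ : i ∈ n)` embeds in `ℝ(T)`, by restriction of
rational functions to a general line. -/
lemma exists_algHom_ratFunc {F : Type*} [Field F] [Algebra ℝ F]
    (φ : F →ₐ[ℝ] FractionRing (MvPolynomial n ℝ)) (t θ : F) (ht : Transcendental ℝ t)
    (hθ : Algebra.adjoin (IntermediateField.adjoin ℝ {t}) {θ} = ⊤) :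
    Nonempty (F →ₐ[ℝ] RatFunc ℝ) := by
  let Q := FractionRing (MvPolynomial n ℝ)
  obtain ⟨f, h₀, hh₀, hf⟩ := IsFractionRing.div_surjective (A := MvPolynomial n ℝ) (φ t)
  obtain ⟨e, h₁, hh₁, he⟩ := IsFractionRing.div_surjective (A := MvPolynomial n ℝ) (φ θ)
  replace hh₀ := nonZeroDivisors.ne_zero hh₀
  replace hh₁ := nonZeroDivisors.ne_zero hh₁
  -- Two points at which `t` takes different values.
  obtain ⟨P, hP⟩ : ∃ P, MvPolynomial.eval P (h₀ * h₁) ≠ 0 := by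
    by_contra! h
    exact mul_ne_zero hh₀ hh₁ (MvPolynomial.funext fun x ↦ by rw [h, map_zero])
  have hP0 : MvPolynomial.eval P h₀ ≠ 0 := by rw [map_mul] at hP; exact left_ne_zero_of_mul hP
  have hP1 : MvPolynomial.eval P h₁ ≠ 0 := by rw [map_mul] at hP; exact right_ne_zero_of_mul hP
  set c := MvPolynomial.eval P f / MvPolynomial.eval P h₀ with hc
  have hne : f - MvPolynomial.C c * h₀ ≠ 0 := by
    intro h
    rw [sub_eq_zero] at h
    have hh : algebraMap (MvPolynomial n ℝ) Q h₀ ≠ 0 := by simpa [Q] using hh₀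
    have h2 : φ t = φ (algebraMap ℝ F c) := by
      rw [← hf, h, map_mul, mul_div_assoc, div_self hh, mul_one, φ.commutes,
        IsScalarTower.algebraMap_apply ℝ (MvPolynomial n ℝ) Q]
      rfl
    rw [φ.injective h2] at ht
    exact ht (isAlgebraic_algebraMap c)
  obtain ⟨P', hP'⟩ : ∃ P', MvPolynomial.eval P' (h₀ * (f - MvPolynomial.C c * h₀)) ≠ 0 := by
    by_contra! h
    exact mul_ne_zero hh₀ hne (MvPolynomial.funext fun x ↦ by rw [h, map_zero])
  rw [map_mul, map_sub, map_mul, MvPolynomial.eval_C] at hP'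
  -- Restriction to the line through the two points.
  let l : MvPolynomial n ℝ →ₐ[ℝ] Polynomial ℝ := MvPolynomial.aeval fun i ↦
    Polynomial.C (P i) + Polynomial.X * Polynomial.C (P' i - P i)
  have hl0 : ∀ p, (l p).eval 0 = MvPolynomial.eval P p := by
    intro p
    have : ((Polynomial.aeval (0 : ℝ)).comp l) = MvPolynomial.aeval P := by
      ext i; simp [l]
    have := AlgHom.congr_fun this p
    simpa [MvPolynomial.aeval_eq_eval] using this
  have hl1 : ∀ p, (l p).eval 1 = MvPolynomial.eval P' p := by
    intro p
    have : ((Polynomial.aeval (1 : ℝ)).comp l) = MvPolynomial.aeval P' := by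
      ext i; simp [l]
    have := AlgHom.congr_fun this p
    simpa [MvPolynomial.aeval_eq_eval] using this
  let S : Submonoid (MvPolynomial n ℝ) := (nonZeroDivisors (Polynomial ℝ)).comap l
  have hS : ∀ p, p ∈ S ↔ l p ≠ 0 := fun p ↦ by
    rw [Submonoid.mem_comap, mem_nonZeroDivisors_iff_ne_zero]
  have hSle : S ≤ nonZeroDivisors (MvPolynomial n ℝ) := by
    intro p hp
    rw [mem_nonZeroDivisors_iff_ne_zero]
    rintro rfl
    exact (hS 0).1 hp (map_zero l)
  have hh₀S : h₀ ∈ S := (hS _).2 fun h ↦ hP0 (by rw [← hl0, h, Polynomial.eval_zero])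
  have hh₁S : h₁ ∈ S := (hS _).2 fun h ↦ hP1 (by rw [← hl0, h, Polynomial.eval_zero])
  let V : Subalgebra (MvPolynomial n ℝ) Q := Localization.subalgebra.ofField Q S hSle
  have hV : ∀ z : Q, z ∈ V ↔ ∃ (p s : MvPolynomial n ℝ), s ∈ S ∧
      z = algebraMap _ Q p * (algebraMap _ Q s)⁻¹ := fun z ↦
    ⟨fun ⟨p, s, hs, h⟩ ↦ ⟨p, s, hs, h⟩, fun ⟨p, s, hs, h⟩ ↦ ⟨p, s, hs, h⟩⟩
  have hunit : ∀ s : S, IsUnit (((algebraMap (Polynomial ℝ) (RatFunc ℝ)).comp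
      (l : MvPolynomial n ℝ →+* Polynomial ℝ)) s) := fun s ↦
    (RatFunc.algebraMap_ne_zero ((hS s).1 s.2)).isUnit
  let σ : V →+* RatFunc ℝ := IsLocalization.lift (M := S) hunit
  have hσ : ∀ p, σ (algebraMap _ V p) = algebraMap _ _ (l p) := fun p ↦
    IsLocalization.lift_eq hunit p
  have hσC : ∀ r, σ (algebraMap ℝ V r) = algebraMap ℝ (RatFunc ℝ) r := by
    intro r
    rw [IsScalarTower.algebraMap_apply ℝ (MvPolynomial n ℝ) V, hσ,
      IsScalarTower.algebraMap_apply ℝ (Polynomial ℝ) (RatFunc ℝ)]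
    exact congrArg _ (l.commutes r)
  have htV : φ t ∈ V := (hV _).2 ⟨f, h₀, hh₀S, by rw [← hf, div_eq_mul_inv]⟩
  have hθV : φ θ ∈ V := (hV _).2 ⟨e, h₁, hh₁S, by rw [← he, div_eq_mul_inv]⟩
  let σA : V →ₐ[ℝ] RatFunc ℝ := ⟨σ, hσC⟩
  have ht' : Transcendental ℝ (σA ⟨φ t, htV⟩) := by
    refine RatFunc.transcendental_of_ne_C _ ?_
    rintro ⟨d, hd⟩
    have h1 : (⟨φ t, htV⟩ : V) * algebraMap _ V h₀ = algebraMap _ V f := by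
      refine Subtype.ext ?_
      change φ t * algebraMap _ Q h₀ = algebraMap _ Q f
      rw [← hf, div_mul_cancel₀]
      simpa [Q] using hh₀
    have h2 := congrArg σ h1
    rw [map_mul, hσ, hσ] at h2
    change σ _ = _ at hd
    rw [hd, ← RatFunc.algebraMap_C, ← map_mul] at h2
    have h3 := RatFunc.algebraMap_injective ℝ h2
    have h4 := congrArg (Polynomial.eval 0) h3
    have h5 := congrArg (Polynomial.eval 1) h3
    rw [Polynomial.eval_mul, Polynomial.eval_C, hl0, hl0] at h4
    rw [Polynomial.eval_mul, Polynomial.eval_C, hl1, hl1] at h5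
    have h6 : d = c := by rw [hc, eq_div_iff hP0, h4]
    apply hP'
    rw [← h5, h6, sub_self, mul_zero]
  have hinv : ∀ z : V, σA z ≠ 0 → (z : Q)⁻¹ ∈ V := by
    rintro ⟨z, hz⟩ hne
    obtain ⟨p, s, hs, rfl⟩ := (hV z).1 hz
    have h1 : (⟨_, hz⟩ : V) * algebraMap _ V s = algebraMap _ V p := by
      refine Subtype.ext ?_
      change algebraMap _ Q p * (algebraMap _ Q s)⁻¹ * algebraMap _ Q s = algebraMap _ Q p
      rw [inv_mul_cancel_right₀]
      simpa [Q] using nonZeroDivisors.ne_zero (hSle hs)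
    have h2 := congrArg σ h1
    rw [map_mul, hσ, hσ] at h2
    refine (hV _).2 ⟨s, p, (hS p).2 fun hp ↦ ?_, by rw [mul_inv, inv_inv, mul_comm]⟩
    rw [hp, map_zero] at h2
    exact (mul_ne_zero hne (RatFunc.algebraMap_ne_zero ((hS s).1 hs))) h2
  have haeval : ∀ p : Polynomial ℝ, φ (Polynomial.aeval t p) =
      (Polynomial.aeval (⟨φ t, htV⟩ : V) p : V) := by
    intro p
    rw [← Polynomial.aeval_algHom_apply]
    exact Polynomial.aeval_algHom_apply ((V.restrictScalars ℝ).val) (⟨φ t, htV⟩ : V) p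
  have hall : ∀ z, φ z ∈ V := by
    intro z
    have hz : z ∈ Algebra.adjoin (IntermediateField.adjoin ℝ {t}) {θ} := by rw [hθ]; trivial
    induction hz using Algebra.adjoin_induction with
    | mem z hz => rw [Set.mem_singleton_iff.1 hz]; exact hθV
    | algebraMap k =>
      obtain ⟨p, q, hpq⟩ := (IntermediateField.mem_adjoin_simple_iff ℝ (k : F)).1 k.2
      change φ (k : F) ∈ V
      rw [hpq, map_div₀, haeval, haeval, div_eq_mul_inv]
      by_cases hq : q = 0
      · rw [hq, map_zero]
        simp
      · refine V.mul_mem (Subtype.property _) (hinv _ ?_)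
        rw [← Polynomial.aeval_algHom_apply]
        exact fun h ↦ hq (transcendental_iff.1 ht' q h)
    | add z w _ _ hz hw => rw [map_add]; exact V.add_mem hz hw
    | mul z w _ _ hz hw => rw [map_mul]; exact V.mul_mem hz hw
  exact ⟨σA.comp (φ.codRestrict (V.restrictScalars ℝ) hall)⟩

/-- A finite extension of `ℝ(t)` that embeds in `ℝ(xᵢ : i ∈ n)` is purely transcendental over `ℝ`,
or `ℝ` itself. -/
lemma exists_adjoin_simple_eq_top {F : Type*} [Field F] [Algebra ℝ F]
    (φ : F →ₐ[ℝ] FractionRing (MvPolynomial n ℝ)) (t : F)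
    [FiniteDimensional (IntermediateField.adjoin ℝ {t}) F] :
    ∃ τ : F, IntermediateField.adjoin ℝ {τ} = ⊤ := by
  by_cases ht : Transcendental ℝ t
  · obtain ⟨θ, hθ⟩ := Field.exists_primitive_element (IntermediateField.adjoin ℝ {t}) F
    have hθ' : Algebra.adjoin (IntermediateField.adjoin ℝ {t}) {θ} = ⊤ := by
      rw [← IntermediateField.adjoin_simple_toSubalgebra_of_isAlgebraic
        (Algebra.IsAlgebraic.isAlgebraic θ), hθ, IntermediateField.top_toSubalgebra]
    obtain ⟨ψ⟩ := exists_algHom_ratFunc φ t θ ht hθ'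
    have hgen : RatFunc.Luroth.generator ψ.fieldRange ∈ ψ.fieldRange :=
      RatFunc.Luroth.generator_mem
    obtain ⟨τ, hτ⟩ := hgen
    refine ⟨τ, IntermediateField.map_injective ψ ?_⟩
    rw [IntermediateField.adjoin_map, Set.image_singleton, ← AlgHom.fieldRange_eq_map]
    refine Eq.trans ?_ RatFunc.Luroth.eq_adjoin_generator.symm
    rw [← hτ]
    rfl
  · have h1 : Algebra.IsAlgebraic ℝ (IntermediateField.adjoin ℝ {t}) :=
      IntermediateField.isAlgebraic_adjoin_simple (not_not.1 ht : IsAlgebraic ℝ t).isIntegral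
    have halg : Algebra.IsAlgebraic ℝ F :=
      Algebra.IsAlgebraic.trans ℝ (IntermediateField.adjoin ℝ {t}) F
    obtain ⟨R, _, _, _, -, ⟨ι⟩⟩ := exists_orderedField_fractionRing n
    obtain ⟨e⟩ := nonempty_algEquiv_real (ι.comp (φ : F →+* _))
    refine ⟨0, ?_⟩
    rw [IntermediateField.adjoin_zero, eq_top_iff]
    intro z _
    exact ⟨e z, e.injective (by simp)⟩

end MvRationalFunctions

/-! ### The two kinds of integral plane conics -/

section Dichotomy

/-- A quadratic form in three variables is a combination of squares of linearly independent linear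
forms. The matrix `P'` inverts the change of coordinates. -/
lemma exists_diagonalization {K : Type*} [Field K] [CharZero K] (q : MvPolynomial (Fin 3) K)
    (hq : q ∈ MvPolynomial.homogeneousSubmodule (Fin 3) K 2) (hq0 : q ≠ 0) :
    ∃ (d : Fin 3 → K) (P P' : Matrix (Fin 3) (Fin 3) K), (∃ i, d i ≠ 0) ∧ P' * P = 1 ∧
      q = ∑ i, MvPolynomial.C (d i) * (∑ k, MvPolynomial.C (P i k) * MvPolynomial.X k) ^ 2 := by
  have hlin : ∀ l ∈ MvPolynomial.homogeneousSubmodule (Fin 3) K 1,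
      ∃ f : (Fin 3 → K) →ₗ[K] K, ∀ w, f w = MvPolynomial.eval w l := by
    intro l hl
    rw [MvPolynomial.homogeneousSubmodule_one_eq_span_X] at hl
    induction hl using Submodule.span_induction with
    | mem l hl =>
      obtain ⟨i, rfl⟩ := hl
      exact ⟨LinearMap.proj i, fun w ↦ by simp⟩
    | zero => exact ⟨0, fun w ↦ by simp⟩
    | add l m _ _ hl hm =>
      obtain ⟨f, hf⟩ := hl
      obtain ⟨g, hg⟩ := hm
      exact ⟨f + g, fun w ↦ by simp [hf, hg]⟩
    | smul c l _ hl =>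
      obtain ⟨f, hf⟩ := hl
      exact ⟨c • f, fun w ↦ by simp [hf, MvPolynomial.smul_eval]⟩
  obtain ⟨Q, hQ⟩ : ∃ Q : QuadraticForm K (Fin 3 → K), ∀ w, Q w = MvPolynomial.eval w q := by
    rw [← MvPolynomial.homogeneousSubmodule_one_pow, pow_two] at hq
    clear hq0
    induction hq using Submodule.mul_induction_on' with
    | mem_mul_mem l hl m hm =>
      obtain ⟨f, hf⟩ := hlin l hl
      obtain ⟨g, hg⟩ := hlin m hm
      exact ⟨QuadraticMap.linMulLin f g, fun w ↦ by simp [hf, hg]⟩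
    | add l _ m _ hl hm =>
      obtain ⟨f, hf⟩ := hl
      obtain ⟨g, hg⟩ := hm
      exact ⟨f + g, fun w ↦ by simp [hf, hg]⟩
  have : Invertible (2 : K) := invertibleOfNonzero two_ne_zero
  obtain ⟨d, ⟨e⟩⟩ := Q.equivalent_weightedSumSquares
  have hfr : Module.finrank K (Fin 3 → K) = 3 := by simp
  revert d
  rw [hfr]
  intro d e
  have he : ∀ w, MvPolynomial.eval w q = ∑ i, d i * (e w i) ^ 2 := by
    intro w
    rw [← hQ, ← e.map_app, QuadraticMap.weightedSumSquares_apply]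
    simp only [smul_eq_mul, pow_two]
  have heP : ∀ w i, e w i =
      ∑ k, LinearMap.toMatrix' (e.toLinearEquiv : (Fin 3 → K) →ₗ[K] _) i k * w k := by
    intro w i
    exact (congrFun (LinearMap.toMatrix'_mulVec (e.toLinearEquiv : (Fin 3 → K) →ₗ[K] _) w) i).symm
  refine ⟨d, LinearMap.toMatrix' (e.toLinearEquiv : (Fin 3 → K) →ₗ[K] _),
    LinearMap.toMatrix' (e.toLinearEquiv.symm : (Fin 3 → K) →ₗ[K] _), ?_, ?_, ?_⟩
  · by_contra! h
    refine hq0 (MvPolynomial.funext fun w ↦ ?_)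
    rw [he, map_zero]
    simp [h]
  · rw [← LinearMap.toMatrix'_comp, LinearEquiv.symm_comp, LinearMap.toMatrix'_id]
  · refine MvPolynomial.funext fun w ↦ ?_
    rw [he]
    simp only [map_sum, map_mul, map_pow, MvPolynomial.eval_C, MvPolynomial.eval_X, heP]

variable {K L : Type*} [Field K] [Field L] [Algebra K L]

/-- If `L` is generated over `K` by an algebraic element `z` and one more element, then `L` is a
simple extension of the algebraic closure of `K` in `L`, and the latter is finite over `K`. -/
lemma exists_algebraicClosure_of_adjoin_pair {z s : L} (hz : IsAlgebraic K z)
    (h : IntermediateField.adjoin K {z, s} = ⊤) (hL : ¬ Algebra.IsAlgebraic K L) :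
    ∃ F : IntermediateField K L, FiniteDimensional K F ∧ (∀ w, IsAlgebraic K w → w ∈ F) ∧
      ∃ s : L, IntermediateField.adjoin F {s} = ⊤ := by
  let F := IntermediateField.adjoin K {z}
  have hfin : FiniteDimensional K F := IntermediateField.adjoin.finiteDimensional hz.isIntegral
  have htop : IntermediateField.adjoin F {s} = ⊤ := by
    rw [eq_top_iff]
    intro w _
    refine mem_of_adjoin_eq_top h (IntermediateField.adjoin F {s}).toSubfield (fun k ↦ ?_) ?_ w
    · exact (IntermediateField.adjoin F {s}).algebraMap_mem (algebraMap K F k)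
    · rintro w (rfl | rfl)
      · exact (IntermediateField.adjoin F {s}).algebraMap_mem
          (IntermediateField.AdjoinSimple.gen K w)
      · exact IntermediateField.mem_adjoin_simple_self F w
  have hs : Transcendental F s := by
    intro hs
    apply hL
    have h1 : Algebra.IsAlgebraic F (IntermediateField.adjoin F {s}) :=
      IntermediateField.isAlgebraic_adjoin_simple hs.isIntegral
    rw [htop] at h1
    have h2 : Algebra.IsAlgebraic F L := (IntermediateField.topEquiv (F := F) (E := L)).isAlgebraic
    exact Algebra.IsAlgebraic.trans K F L
  refine ⟨F, hfin, fun w hw ↦ ?_, s, htop⟩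
  let e : RatFunc F ≃ₐ[F] L := (RatFunc.algEquivOfTranscendental s hs).trans
    ((IntermediateField.equivOfEq htop).trans IntermediateField.topEquiv)
  have hw' : IsAlgebraic F w := hw.tower_top F
  have hw'' : IsAlgebraic F (e.symm w) := (isAlgebraic_algHom_iff (e.symm : L →ₐ[F] RatFunc F)
    e.symm.injective).2 hw'
  obtain ⟨c, hc⟩ : ∃ c, e.symm w = RatFunc.C c := by
    by_contra hne
    exact RatFunc.transcendental_of_ne_C _ hne hw''
  rw [AlgEquiv.symm_apply_eq, ← RatFunc.algebraMap_eq_C, e.commutes] at hc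
  rw [hc]
  exact c.2

/-- A field `L` that is generated over `K` by the ratios of the homogeneous coordinates of a point
of a plane conic is either the function field of a smooth conic over `K`, or a simple extension of
the algebraic closure of `K` in `L`. -/
theorem isConicField_or [CharZero K] (q : MvPolynomial (Fin 3) K)
    (hq : q ∈ MvPolynomial.homogeneousSubmodule (Fin 3) K 2) (hq0 : q ≠ 0) (v : Fin 3 → L)
    (hv : ∃ i, v i = 1) (hvq : MvPolynomial.aeval v q = 0)
    (htop : IntermediateField.adjoin K (Set.range v) = ⊤) :
    (∃ (a b : K) (x y : L), IsConicField K a b x y) ∨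
      ∃ F : IntermediateField K L, FiniteDimensional K F ∧ (∀ w, IsAlgebraic K w → w ∈ F) ∧
        ∃ s : L, IntermediateField.adjoin F {s} = ⊤ := by
  by_cases halg : Algebra.IsAlgebraic K L
  · refine Or.inr ⟨⊤, ?_, fun w _ ↦ trivial, 0, ?_⟩
    · rw [← htop]
      exact IntermediateField.finiteDimensional_adjoin fun z _ ↦
        (Algebra.IsAlgebraic.isAlgebraic z).isIntegral
    · rw [eq_top_iff]
      intro w _
      exact (IntermediateField.adjoin (⊤ : IntermediateField K L) {(0 : L)}).algebraMap_mem
        (⟨w, trivial⟩ : (⊤ : IntermediateField K L))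
  obtain ⟨d, P, P', ⟨m, hm⟩, hPP, rfl⟩ := exists_diagonalization q hq hq0
  set u : Fin 3 → L := fun i ↦ ∑ k, algebraMap K L (P i k) * v k with hu
  have hsum : ∑ i, algebraMap K L (d i) * u i ^ 2 = 0 := by
    rw [← hvq]
    simp [hu]
  have hvu : ∀ k, v k = ∑ i, algebraMap K L (P' k i) * u i := by
    intro k
    have h1 := congrFun (congrArg (fun M ↦ (M.map (algebraMap K L)).mulVec v) hPP) k
    simp only [Matrix.map_mul, ← Matrix.mulVec_mulVec, Matrix.map_one _ (map_zero _) (map_one _),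
      Matrix.one_mulVec] at h1
    exact h1.symm
  -- The ratios of the new coordinates generate `L`.
  have hgen : ∀ l, u l ≠ 0 → ∀ S : IntermediateField K L, (∀ i, u i / u l ∈ S) → S = ⊤ := by
    intro l hl S hS
    obtain ⟨i₀, hi₀⟩ := hv
    have h1 : ∀ k, v k / u l ∈ S := by
      intro k
      rw [hvu, Finset.sum_div]
      refine S.sum_mem fun i _ ↦ ?_
      rw [mul_div_assoc]
      exact S.mul_mem (S.algebraMap_mem _) (hS i)
    have h2 : u l ∈ S := by
      have := S.inv_mem (h1 i₀)
      rwa [hi₀, one_div, inv_inv] at this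
    rw [eq_top_iff, ← htop, IntermediateField.adjoin_le_iff]
    rintro _ ⟨k, rfl⟩
    have := S.mul_mem (h1 k) h2
    rwa [div_mul_cancel₀ _ hl] at this
  have hu0 : ∃ l, u l ≠ 0 := by
    by_contra! h
    obtain ⟨i₀, hi₀⟩ := hv
    rw [hvu] at hi₀
    simp [h] at hi₀
  have halgtop : ∀ l, u l ≠ 0 → (∀ i, IsAlgebraic K (u i / u l)) → False := by
    intro l hl h
    have h1 := hgen l hl (algebraicClosure K L) fun i ↦ mem_algebraicClosure_iff.2 (h i)
    exact halg ⟨fun z ↦ mem_algebraicClosure_iff.1 (h1 ▸ trivial : z ∈ algebraicClosure K L)⟩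
  -- A binary form vanishes only at algebraic points.
  have hbin : ∀ {a b : K} {x y : L}, a ≠ 0 → y ≠ 0 →
      algebraMap K L a * x ^ 2 + algebraMap K L b * y ^ 2 = 0 → IsAlgebraic K (x / y) := by
    intro a b x y ha hy h
    refine IsAlgebraic.of_pow (n := 2) zero_lt_two ?_
    have : (x / y) ^ 2 = algebraMap K L (-b / a) := by
      have ha' : algebraMap K L a ≠ 0 := by simpa using ha
      rw [map_div₀, map_neg]
      field_simp
      linear_combination h
    rw [this]
    exact isAlgebraic_algebraMap _
  have hself : ∀ l, u l ≠ 0 → IsAlgebraic K (u l / u l) := fun l hl ↦ by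
    rw [div_self hl]; exact isAlgebraic_one
  rw [Fin.sum_univ_three] at hsum
  by_cases hall : ∀ i, d i ≠ 0
  · left
    have h0 : algebraMap K L (d 0) ≠ 0 := by simpa using hall 0
    have hu2 : u 2 ≠ 0 := by
      intro h2
      rw [h2, zero_pow two_ne_zero, mul_zero, add_zero] at hsum
      have h1 : u 1 ≠ 0 := by
        intro h1
        rw [h1, zero_pow two_ne_zero, mul_zero, add_zero] at hsum
        have h0' : u 0 = 0 := by simpa [h0] using hsum
        obtain ⟨l, hl⟩ := hu0
        fin_cases l
        exacts [hl h0', hl h1, hl h2]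
      refine halgtop 1 h1 fun i ↦ ?_
      fin_cases i
      · exact hbin (hall 0) h1 hsum
      · exact hself 1 h1
      · simp only [Fin.reduceFinMk, h2, zero_div]
        exact isAlgebraic_zero
    refine ⟨-(d 1) / d 0, -(d 2) / d 0, u 0 / u 2, u 1 / u 2,
      div_ne_zero (neg_ne_zero.2 (hall 1)) (hall 0), div_ne_zero (neg_ne_zero.2 (hall 2)) (hall 0),
      ?_, hgen 2 hu2 _ fun i ↦ ?_, halg⟩
    · rw [map_div₀, map_div₀, map_neg, map_neg]
      field_simp
      linear_combination hsum
    · fin_cases i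
      · exact IntermediateField.subset_adjoin _ _ (by simp)
      · exact IntermediateField.subset_adjoin _ _ (by simp)
      · simp only [Fin.reduceFinMk, div_self hu2]
        exact one_mem _
  · right
    push Not at hall
    obtain ⟨l, hl⟩ := hall
    have hlm : l ≠ m := by rintro rfl; exact hm hl
    obtain ⟨k, hkm, hkl, hall⟩ : ∃ k, k ≠ m ∧ k ≠ l ∧ ∀ i, i = m ∨ i = l ∨ i = k := by
      clear * - hlm
      revert l m
      decide
    have hmk : algebraMap K L (d m) * u m ^ 2 + algebraMap K L (d k) * u k ^ 2 = 0 := by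
      have hset : (Finset.univ : Finset (Fin 3)) = {m, l, k} := by
        ext i
        simpa using hall i
      have h1 : ∑ i, algebraMap K L (d i) * u i ^ 2 = 0 := by rw [Fin.sum_univ_three, hsum]
      rw [hset, Finset.sum_insert (by simp [hlm.symm, hkm.symm]), Finset.sum_pair hkl.symm, hl,
        map_zero, zero_mul, zero_add] at h1
      exact h1
    have huk : u k ≠ 0 := by
      intro hk
      rw [hk, zero_pow two_ne_zero, mul_zero, add_zero] at hmk
      have hum : u m = 0 := by simpa [hm] using hmk
      have hul : u l ≠ 0 := by
        intro hul
        obtain ⟨i, hi⟩ := hu0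
        rcases hall i with rfl | rfl | rfl
        exacts [hi hum, hi hul, hi hk]
      refine halgtop l hul fun i ↦ ?_
      rcases hall i with rfl | rfl | rfl
      · rw [hum, zero_div]; exact isAlgebraic_zero
      · exact hself _ hul
      · rw [hk, zero_div]; exact isAlgebraic_zero
    refine exists_algebraicClosure_of_adjoin_pair (z := u m / u k) (s := u l / u k)
      (hbin hm huk hmk) (hgen k huk _ fun i ↦ ?_) halg
    rcases hall i with rfl | rfl | rfl
    · exact IntermediateField.subset_adjoin _ _ (by simp)
    · exact IntermediateField.subset_adjoin _ _ (by simp)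
    · rw [div_self huk]
      exact one_mem _

end Dichotomy

section Field

variable {n : Type v} {L : Type*} [Field L] [Algebra ℝ L]

/-- A finite extension of `K = ℝ(t)` that embeds in `ℝ(xᵢ : i ∈ n)` is generated over `ℝ` by one
element, where `K` need not be given as a subfield. -/
lemma exists_adjoin_simple_eq_top_of_finite {K F : Type*} [Field K] [Algebra ℝ K] [Field F]
    [Algebra ℝ F] [Algebra K F] [IsScalarTower ℝ K F] [FiniteDimensional K F]
    (φ : F →ₐ[ℝ] FractionRing (MvPolynomial n ℝ)) (t : K)
    (ht : IntermediateField.adjoin ℝ {t} = ⊤) :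
    ∃ τ : F, IntermediateField.adjoin ℝ {τ} = ⊤ := by
  have hmem : ∀ k, algebraMap K F k ∈ IntermediateField.adjoin ℝ {algebraMap K F t} := by
    intro k
    have h := IntermediateField.adjoin_map (F := ℝ) {t} (IsScalarTower.toAlgHom ℝ K F)
    rw [ht, Set.image_singleton] at h
    change _ ∈ IntermediateField.adjoin ℝ {(IsScalarTower.toAlgHom ℝ K F) t}
    rw [← h]
    exact ⟨k, trivial, rfl⟩
  let i : K →+* IntermediateField.adjoin ℝ {algebraMap K F t} :=
    (algebraMap K F).codRestrict _ hmem
  let : Algebra K (IntermediateField.adjoin ℝ {algebraMap K F t}) := i.toAlgebra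
  have : IsScalarTower K (IntermediateField.adjoin ℝ {algebraMap K F t}) F :=
    IsScalarTower.of_algebraMap_eq fun k ↦ rfl
  have : FiniteDimensional (IntermediateField.adjoin ℝ {algebraMap K F t}) F :=
    Module.Finite.of_restrictScalars_finite K _ F
  exact exists_adjoin_simple_eq_top φ (algebraMap K F t)

/-- A finite group of automorphisms of the function field `L` of a plane conic over `K = ℝ(t)`
that preserve `K` has a normal abelian subgroup of index at most `8`, if `L` embeds in a field of
rational functions over `ℝ`. -/
theorem exists_normal_abelian_of_conic {G : Type*} [Group G] [Finite G]
    (ρ : G →* (L ≃ₐ[ℝ] L)) (hρ : Function.Injective ρ)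
    (K : IntermediateField ℝ L) (hK : ∀ g, ∀ z ∈ K, ρ g z ∈ K)
    (t : L) (ht : K = IntermediateField.adjoin ℝ {t})
    (φ : L →ₐ[ℝ] FractionRing (MvPolynomial n ℝ))
    (q : MvPolynomial (Fin 3) K)
    (hq : q ∈ MvPolynomial.homogeneousSubmodule (Fin 3) K 2) (hq0 : q ≠ 0) (v : Fin 3 → L)
    (hv : ∃ i, v i = 1) (hvq : MvPolynomial.aeval v q = 0)
    (htop : IntermediateField.adjoin K (Set.range v) = ⊤) :
    ∃ A : Subgroup G, A.Normal ∧ IsMulCommutative A ∧ A.index ≤ 8 := by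
  obtain ⟨R, _, _, _, hsqrt, ⟨ι⟩⟩ := exists_orderedField_fractionRing n
  rcases isConicField_or q hq hq0 v hv hvq htop with h | ⟨F, hfin, halg, s, hs⟩
  · exact exists_normal_abelian_of_isConicField ρ hρ K hK t ht (ι.comp (φ : L →+* _)) hsqrt
      (Or.inr h)
  · let K' : IntermediateField ℝ L := F.restrictScalars ℝ
    have hK' : ∀ g, ∀ z ∈ K', ρ g z ∈ K' := by
      intro g z hz
      refine halg _ ?_
      have h1 : IsAlgebraic K z :=
        isAlgebraic_algebraMap_iff (A := L) (a := (⟨z, hz⟩ : F)) F.val.injective |>.2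
          (Algebra.IsAlgebraic.isAlgebraic _)
      exact h1.ringHom_of_comp_eq (restrictHom ρ K hK g : K →+* K) (ρ g : L →+* L)
        (restrictHom ρ K hK g).injective rfl
    have htK : t ∈ K := ht ▸ IntermediateField.mem_adjoin_simple_self ℝ t
    have htop' : IntermediateField.adjoin ℝ {(⟨t, htK⟩ : K)} = ⊤ := by
      apply IntermediateField.map_injective K.val
      rw [IntermediateField.adjoin_map, Set.image_singleton, ← AlgHom.fieldRange_eq_map,
        IntermediateField.fieldRange_val]
      exact ht.symm
    let : Algebra ℝ F := ((algebraMap K F).comp (algebraMap ℝ K)).toAlgebra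
    have : IsScalarTower ℝ K F := .of_algebraMap_eq fun r ↦ rfl
    let i : F →ₐ[ℝ] L := F.val.restrictScalars ℝ
    let ψ := φ.comp i
    obtain ⟨τ, hτ⟩ := exists_adjoin_simple_eq_top_of_finite (K := K) (F := F) ψ ⟨t, htK⟩ htop'
    have hτ' : K' = IntermediateField.adjoin ℝ {(τ : L)} := by
      have h := IntermediateField.adjoin_map (F := ℝ) {τ} i
      rw [hτ, Set.image_singleton] at h
      refine Eq.trans ?_ h
      ext z
      exact ⟨fun hz ↦ ⟨⟨z, hz⟩, trivial, rfl⟩, fun ⟨w, _, hw⟩ ↦ hw ▸ w.2⟩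
    refine exists_normal_abelian_of_isConicField ρ hρ K' hK' τ hτ' (ι.comp (φ : L →+* _)) hsqrt ?_
    by_cases hsalg : IsAlgebraic F s
    · left
      rw [eq_top_iff]
      intro w _
      have h1 : Algebra.IsAlgebraic F (IntermediateField.adjoin F {s}) :=
        IntermediateField.isAlgebraic_adjoin_simple hsalg.isIntegral
      rw [hs] at h1
      have h2 : Algebra.IsAlgebraic F L :=
        (IntermediateField.topEquiv (F := F) (E := L)).isAlgebraic
      have h3 : Algebra.IsAlgebraic K L := Algebra.IsAlgebraic.trans K F L
      exact halg w (h3.isAlgebraic w)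
    · -- The function field of the line is that of the conic `x² - y² = 1`.
      right
      have hs0 : s ≠ 0 := by rintro rfl; exact hsalg isAlgebraic_zero
      have h2 : (2 : L) ≠ 0 := by
        have : CharZero L := charZero_of_injective_algebraMap (algebraMap ℝ L).injective
        exact two_ne_zero
      refine ⟨1, 1, (s + s⁻¹) / 2, (s⁻¹ - s) / 2, one_ne_zero, one_ne_zero, ?_, ?_,
        fun h ↦ hsalg (h.isAlgebraic s)⟩
      · rw [map_one]
        field_simp
        ring
      · rw [eq_top_iff]
        intro w _
        refine mem_of_adjoin_eq_top hs
          (IntermediateField.adjoin K' {(s + s⁻¹) / 2, (s⁻¹ - s) / 2}).toSubfield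
          (fun k ↦ (IntermediateField.adjoin K' _).algebraMap_mem (⟨k, k.2⟩ : K')) ?_ w
        rintro z rfl
        have : z = (z + z⁻¹) / 2 - (z⁻¹ - z) / 2 := by field_simp; ring
        rw [this]
        exact sub_mem (IntermediateField.subset_adjoin _ _ (by rw [← this]; simp))
          (IntermediateField.subset_adjoin _ _ (by rw [← this]; simp))

end Field

/-! ### Points of schemes with values in fields -/

section Points

universe w

variable {X : Scheme.{w}} {M : Type w} [Field M]

/-- A point with values in a field factors through the spectrum of the residue field. -/
lemma exists_SpecMap_fromSpecResidueField (f : Spec (.of M) ⟶ X) {x : X}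
    (hx : f (IsLocalRing.closedPoint M) = x) :
    ∃ φ : X.residueField x ⟶ .of M, Spec.map φ ≫ X.fromSpecResidueField x = f := by
  subst hx
  exact ⟨_, Scheme.descResidueField_stalkClosedPointTo_fromSpecResidueField M X f⟩

lemma eq_of_SpecMap_fromSpecResidueField {x : X} {R : CommRingCat.{w}}
    {φ ψ : X.residueField x ⟶ R}
    (h : Spec.map φ ≫ X.fromSpecResidueField x = Spec.map ψ ≫ X.fromSpecResidueField x) :
    φ = ψ :=
  Spec.map_injective ((cancel_mono _).1 h)

/-- The residue field is the smallest field over which a point is defined. -/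
lemma surjective_of_SpecMap_comp_eq {x : X} (i : CommRingCat.of M ⟶ X.residueField x)
    (f : Spec (.of M) ⟶ X) (h : Spec.map i ≫ f = X.fromSpecResidueField x) :
    Function.Surjective i := by
  have hx : f (IsLocalRing.closedPoint M) = x := by
    have h1 : (Spec.map i ≫ f) (IsLocalRing.closedPoint (X.residueField x)) = x := by
      rw [h]
      exact Scheme.fromSpecResidueField_apply _ _
    exact (congrArg f (Subsingleton.elim (α := PrimeSpectrum M) _ _)).trans h1
  obtain ⟨φ, hφ⟩ := exists_SpecMap_fromSpecResidueField f hx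
  have h2 : φ ≫ i = 𝟙 _ := by
    apply eq_of_SpecMap_fromSpecResidueField
    rw [Spec.map_comp, Category.assoc, hφ, h, Spec.map_id, Category.id_comp]
  intro z
  exact ⟨φ z, congrArg (fun k ↦ k z) h2⟩

end Points

/-! ### Points of projective space with values in fields -/

section ProjectiveSpace

universe w

variable (n : ℕ) (k : Type w) [Field k]

lemma X_mem_grading (j : Fin (n + 1)) : MvPolynomial.X j ∈ grading n k 1 :=
  MvPolynomial.isHomogeneous_X k j

/-- The inclusion of the standard chart `{x_j ≠ 0}`, as a morphism from an affine scheme. -/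
noncomputable abbrev chartι (j : Fin (n + 1)) :
    Spec (.of (HomogeneousLocalization.Away (grading n k) (MvPolynomial.X j))) ⟶
      Proj (grading n k) :=
  Proj.awayι (grading n k) (MvPolynomial.X j) (X_mem_grading n k j) one_pos

/-- The coordinate `x_i / x_j` on the standard chart `{x_j ≠ 0}`. -/
noncomputable def chartCoord (j i : Fin (n + 1)) :
    HomogeneousLocalization.Away (grading n k) (MvPolynomial.X j) :=
  HomogeneousLocalization.Away.mk (grading n k) (X_mem_grading n k j) 1
    (MvPolynomial.X i) (by simpa using MvPolynomial.isHomogeneous_X k i)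

/-- The constants as functions on the standard chart `{x_j ≠ 0}`. -/
noncomputable def chartConst (j : Fin (n + 1)) :
    k →+* HomogeneousLocalization.Away (grading n k) (MvPolynomial.X j) :=
  (HomogeneousLocalization.fromZeroRingHom (grading n k) _).comp (algebraMap k (grading n k 0))

variable {n k}

lemma exists_mem_chart (x : Proj (grading n k)) : ∃ j, x ∈ (chart n k j).1 := by
  have hA : Algebra.adjoin (grading n k 0)
      (Set.range (MvPolynomial.X (R := k) (σ := Fin (n + 1)))) = ⊤ := by
    rw [eq_top_iff]
    intro p _
    induction p using MvPolynomial.induction_on with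
    | C a =>
      exact Subalgebra.algebraMap_mem _
        (⟨MvPolynomial.C a, MvPolynomial.isHomogeneous_C _ a⟩ : grading n k 0)
    | add p q hp hq => exact add_mem (hp trivial) (hq trivial)
    | mul_X p i hp => exact mul_mem (hp trivial) (Algebra.subset_adjoin ⟨i, rfl⟩)
  have h := Proj.iSup_basicOpen_eq_top' (grading n k) MvPolynomial.X
    (fun j ↦ ⟨1, X_mem_grading n k j⟩) hA
  exact TopologicalSpace.Opens.mem_iSup.1 (h ▸ TopologicalSpace.Opens.mem_top x)

lemma chartCoord_self (j : Fin (n + 1)) : chartCoord n k j j = 1 := by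
  apply HomogeneousLocalization.val_injective
  rw [chartCoord, HomogeneousLocalization.Away.val_mk, HomogeneousLocalization.val_one]
  simp only [pow_one]
  exact Localization.mk_self ⟨MvPolynomial.X j, _⟩

/-- The dehomogenization of a form is its value at the coordinates of the chart. -/
lemma away_mk_eq_eval₂ (j : Fin (n + 1)) (d : ℕ) (p : MvPolynomial (Fin (n + 1)) k)
    (hp : p ∈ grading n k d) (hp' : p ∈ grading n k (d • 1)) :
    HomogeneousLocalization.Away.mk (grading n k) (X_mem_grading n k j) d p hp' =
      p.eval₂ (chartConst n k j) (chartCoord n k j) := by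
  have hX : MvPolynomial.X j ∈ Submonoid.powers (MvPolynomial.X (R := k) j) := ⟨1, pow_one _⟩
  let R := Localization (Submonoid.powers (MvPolynomial.X (R := k) j))
  let u : R := Localization.mk 1 ⟨MvPolynomial.X j, hX⟩
  apply HomogeneousLocalization.val_injective
  have h1 : (p.eval₂ (chartConst n k j) (chartCoord n k j)).val =
      p.eval₂ ((algebraMap (MvPolynomial (Fin (n + 1)) k) R).comp MvPolynomial.C)
        (fun i ↦ algebraMap (MvPolynomial (Fin (n + 1)) k) R (MvPolynomial.X i) * u) := by
    have h3 := MvPolynomial.hom_eval₂ p (chartConst n k j) (algebraMap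
      (HomogeneousLocalization.Away (grading n k) (MvPolynomial.X j)) R) (chartCoord n k j)
    refine h3.trans ?_
    congr 1
    · funext i
      change (chartCoord n k j i).val = _
      rw [chartCoord, HomogeneousLocalization.Away.val_mk, ← Localization.mk_one_eq_algebraMap]
      refine Eq.trans ?_ (Localization.mk_mul _ _ _ _).symm
      simp only [mul_one, one_mul, pow_one]
  rw [h1, HomogeneousLocalization.Away.val_mk, MvPolynomial.eval₂_eq']
  have h2 : ∀ m ∈ p.support, ∏ i, (algebraMap (MvPolynomial (Fin (n + 1)) k) R
      (MvPolynomial.X i) * u) ^ m i =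
      algebraMap (MvPolynomial (Fin (n + 1)) k) R (∏ i, MvPolynomial.X i ^ m i) * u ^ d := by
    intro m hm
    have hd : ∑ i, m i = d := by
      have h3 := (MvPolynomial.mem_homogeneousSubmodule d p).1 hp
        (MvPolynomial.mem_support_iff.1 hm)
      simpa [Finsupp.weight_apply, Finsupp.sum_fintype] using h3
    simp only [mul_pow, Finset.prod_mul_distrib, Finset.prod_pow_eq_pow_sum, hd, map_prod, map_pow]
  rw [Finset.sum_congr rfl fun m hm ↦ by rw [h2 m hm, ← mul_assoc, RingHom.comp_apply, ← map_mul],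
    ← Finset.sum_mul, ← map_sum, ← MvPolynomial.eval₂_eq', MvPolynomial.eval₂_eta]
  simp only [u, R, Localization.mk_pow, one_pow]
  rw [← Localization.mk_one_eq_algebraMap, Localization.mk_mul, mul_one, one_mul]
  rfl

/-- A point of projective space with values in a field `M` lies in a standard chart, and is given
there by homogeneous coordinates `v` in `M`. -/
lemma exists_chart_of_point {M : Type w} [Field M] [Algebra k M]
    (f : Spec (.of M) ⟶ Proj (grading n k))
    (hf : f ≫ Proj.toSpecZero (grading n k) ≫
      Spec.map (CommRingCat.ofHom (algebraMap k (grading n k 0))) =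
        Spec.map (CommRingCat.ofHom (algebraMap k M))) :
    ∃ (j : Fin (n + 1)) (φ : HomogeneousLocalization.Away (grading n k) (MvPolynomial.X j) →+* M)
      (v : Fin (n + 1) → M), Spec.map (CommRingCat.ofHom φ) ≫ chartι n k j = f ∧ v j = 1 ∧
      (∀ c, φ (chartConst n k j c) = algebraMap k M c) ∧
      ∀ (d : ℕ) (p : MvPolynomial (Fin (n + 1)) k), p ∈ grading n k d →
        ∀ hp : p ∈ grading n k (d • 1),
        φ (HomogeneousLocalization.Away.mk (grading n k) (X_mem_grading n k j) d p hp)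
          = MvPolynomial.aeval v p := by
  obtain ⟨j, hj⟩ := exists_mem_chart (f (IsLocalRing.closedPoint M))
  have hrange : Set.range f ⊆ Set.range (chartι n k j) := by
    rintro _ ⟨z, rfl⟩
    rw [Subsingleton.elim (α := PrimeSpectrum M) z (IsLocalRing.closedPoint M)]
    have := Proj.opensRange_awayι (grading n k) (MvPolynomial.X j)
      (X_mem_grading n k j) one_pos
    change _ ∈ Scheme.Hom.opensRange (chartι n k j)
    rw [this]
    exact hj
  let φ := Spec.preimage (IsOpenImmersion.lift (chartι n k j) f hrange)
  have hφ : Spec.map φ ≫ chartι n k j = f := by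
    rw [Spec.map_preimage, IsOpenImmersion.lift_fac]
  have hc : ∀ c, φ (chartConst n k j c) = algebraMap k M c := by
    have h1 : CommRingCat.ofHom (chartConst n k j) ≫ φ = CommRingCat.ofHom (algebraMap k M) := by
      apply Spec.map_injective
      rw [← hf, ← hφ, Category.assoc, Proj.awayι_toSpecZero_assoc, ← Spec.map_comp,
        ← Spec.map_comp]
      rfl
    exact fun c ↦ congrArg (fun m ↦ m c) h1
  refine ⟨j, φ.hom, fun i ↦ φ (chartCoord n k j i), hφ, ?_, hc, fun d p hp hp' ↦ ?_⟩
  · change φ (chartCoord n k j j) = 1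
    rw [chartCoord_self, map_one]
  · rw [away_mk_eq_eval₂ j d p hp, MvPolynomial.hom_eval₂, MvPolynomial.aeval_def]
    congr 1
    exact RingHom.ext hc

lemma chart_preimage_chartι (j : Fin (n + 1)) :
    ⊤ ≤ chartι n k j ⁻¹ᵁ Proj.basicOpen (grading n k) (MvPolynomial.X j) := by
  have h := Proj.opensRange_awayι (grading n k) (MvPolynomial.X j) (X_mem_grading n k j) one_pos
  intro z _
  change chartι n k j z ∈ Proj.basicOpen (grading n k) (MvPolynomial.X j)
  rw [← h]
  exact ⟨z, rfl⟩

/-- Restriction to the affine scheme of a chart inverts the map from the ring of the chart to the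
sections of the structure sheaf over it. -/
lemma awayToSection_appLE (j : Fin (n + 1)) :
    Proj.awayToSection (grading n k) (MvPolynomial.X j) ≫
      (chartι n k j).appLE (Proj.basicOpen (grading n k) (MvPolynomial.X j)) ⊤
        (chart_preimage_chartι j) =
        (Scheme.ΓSpecIso _).inv := by
  set e := Proj.basicOpenIsoSpec (grading n k) (MvPolynomial.X j) (X_mem_grading n k j) one_pos
  have h1 : e.hom.appTop ≫ e.inv.appTop = 𝟙 _ := by
    rw [← Scheme.Hom.comp_appTop, e.inv_hom_id, Scheme.Hom.id_appTop]
  have h2 : e.hom.appTop = (Scheme.ΓSpecIso _).hom ≫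
      Proj.awayToSection (grading n k) (MvPolynomial.X j) ≫
        (Proj.basicOpen (grading n k) (MvPolynomial.X j)).topIso.inv :=
    Proj.basicOpenToSpec_app_top (grading n k) (MvPolynomial.X (R := k) j)
  rw [h2, Category.assoc, ← Iso.eq_inv_comp, Category.comp_id, Category.assoc] at h1
  rw [← h1]
  refine congrArg (_ ≫ ·) ?_
  have h3 : (Proj.basicOpen (grading n k) (MvPolynomial.X j)).topIso.inv =
      (Proj.basicOpen (grading n k) (MvPolynomial.X j)).ι.appLE
        (Proj.basicOpen (grading n k) (MvPolynomial.X j)) ⊤ (by simp) := by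
    rw [Scheme.Opens.ι_appLE]
    rfl
  have h4 : e.inv.appTop = e.inv.appLE ⊤ ⊤ le_top := by
    rw [Scheme.Hom.appTop, Scheme.Hom.app_eq_appLE]
    rfl
  rw [h3, h4]
  exact (Scheme.Hom.appLE_comp_appLE _ _ _ _ _ _ _).symm

/-- If the homogeneous coordinates of a point of projective space lie in a subfield, then the point
is defined over that subfield. -/
lemma exists_point_of_coord_mem {M : Type w} [Field M] [Algebra k M] (S : IntermediateField k M)
    {j : Fin (n + 1)} {φ : HomogeneousLocalization.Away (grading n k) (MvPolynomial.X j) →+* M}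
    {v : Fin (n + 1) → M} (hv : ∀ i, v i ∈ S)
    (hφ : ∀ (d : ℕ) (p : MvPolynomial (Fin (n + 1)) k), p ∈ grading n k d →
        ∀ hp : p ∈ grading n k (d • 1),
        φ (HomogeneousLocalization.Away.mk (grading n k) (X_mem_grading n k j) d p hp)
          = MvPolynomial.aeval v p) :
    ∃ f : Spec (.of S) ⟶ Proj (grading n k),
      Spec.map (CommRingCat.ofHom (algebraMap S M)) ≫ f =
        Spec.map (CommRingCat.ofHom φ) ≫ chartι n k j := by
  have hmem : ∀ a, φ a ∈ S.toSubring := by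
    intro a
    obtain ⟨d, p, hp, rfl⟩ := HomogeneousLocalization.Away.mk_surjective (grading n k)
      (X_mem_grading n k j) a
    rw [hφ d p (by simpa using hp) hp]
    let w : Fin (n + 1) → S := fun i ↦ ⟨v i, hv i⟩
    have h : MvPolynomial.aeval v p = algebraMap S M (MvPolynomial.aeval w p) :=
      MvPolynomial.aeval_algebraMap_apply M w p
    rw [h]
    exact (MvPolynomial.aeval w p).2
  refine ⟨Spec.map (CommRingCat.ofHom (φ.codRestrict S.toSubring hmem)) ≫ chartι n k j, ?_⟩
  rw [← Category.assoc, ← Spec.map_comp]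
  rfl

/-- The residue field of a point of projective space is generated by homogeneous coordinates of the
point. -/
lemma exists_adjoin_range_eq_top (x : Proj (grading n k))
    [Algebra k ((Proj (grading n k)).residueField x)]
    (hx : (Proj (grading n k)).fromSpecResidueField x ≫ Proj.toSpecZero (grading n k) ≫
      Spec.map (CommRingCat.ofHom (algebraMap k (grading n k 0))) =
        Spec.map (CommRingCat.ofHom (algebraMap k ((Proj (grading n k)).residueField x)))) :
    ∃ v : Fin (n + 1) → (Proj (grading n k)).residueField x, (∃ j, v j = 1) ∧
      IntermediateField.adjoin k (Set.range v) = ⊤ := by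
  obtain ⟨j, φ, v, hf, hj, -, hφ⟩ := exists_chart_of_point
    (M := (Proj (grading n k)).residueField x) _ hx
  refine ⟨v, ⟨j, hj⟩, ?_⟩
  obtain ⟨f, hf'⟩ := exists_point_of_coord_mem (IntermediateField.adjoin k (Set.range v))
    (fun i ↦ IntermediateField.subset_adjoin _ _ ⟨i, rfl⟩) hφ
  have := surjective_of_SpecMap_comp_eq _ f (hf'.trans hf)
  rw [eq_top_iff]
  intro z _
  obtain ⟨s, rfl⟩ := this z
  exact s.2

/-- The residue field of a point of the projective line is a simple extension. -/
lemma exists_adjoin_simple_eq_top_residueField (x : Proj (grading 1 k))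
    [Algebra k ((Proj (grading 1 k)).residueField x)]
    (hx : (Proj (grading 1 k)).fromSpecResidueField x ≫ Proj.toSpecZero (grading 1 k) ≫
      Spec.map (CommRingCat.ofHom (algebraMap k (grading 1 k 0))) =
        Spec.map (CommRingCat.ofHom (algebraMap k ((Proj (grading 1 k)).residueField x)))) :
    ∃ t : (Proj (grading 1 k)).residueField x, IntermediateField.adjoin k {t} = ⊤ := by
  obtain ⟨v, ⟨j, hj⟩, hv⟩ := exists_adjoin_range_eq_top x hx
  refine ⟨v (1 - j), ?_⟩
  rw [eq_top_iff, ← hv, IntermediateField.adjoin_le_iff]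
  rintro _ ⟨i, rfl⟩
  have hij : ∀ i j : Fin 2, i = j ∨ i = 1 - j := by decide
  obtain rfl | rfl := hij i j
  · rw [hj]
    exact one_mem _
  · exact IntermediateField.mem_adjoin_simple_self _ _

end ProjectiveSpace

/-! ### Points of plane conics -/

section Conic

universe w

variable {K L : Type w} [Field K] [Field L] [Algebra K L]

/-- A point of a plane conic with values in a field `L` that is not defined over a smaller field
exhibits `L` as generated by the homogeneous coordinates of a zero of a quadratic form. -/
lemma IsReducedConic.exists_coord {F : Over (Spec (.of K))} (hF : IsReducedConic F)
    (f : Spec (.of L) ⟶ F.left)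
    (hf : f ≫ F.hom = Spec.map (CommRingCat.ofHom (algebraMap K L)))
    (hgen : ∀ (S : IntermediateField K L) (g : Spec (.of S) ⟶ F.left),
      Spec.map (CommRingCat.ofHom (algebraMap S L)) ≫ g = f → S = ⊤) :
    ∃ (q : MvPolynomial (Fin 3) K) (v : Fin 3 → L),
      q ∈ MvPolynomial.homogeneousSubmodule (Fin 3) K 2 ∧ q ≠ 0 ∧ (∃ i, v i = 1) ∧
        MvPolynomial.aeval v q = 0 ∧ IntermediateField.adjoin K (Set.range v) = ⊤ := by
  obtain ⟨-, q, hq, i, hq0, hi, hker⟩ := hF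
  let i' : F.left ⟶ Proj (grading 2 K) := i.left
  have hi' : IsClosedImmersion i' := hi
  have hw : i' ≫ Proj.toSpecZero (grading 2 K) ≫
      Spec.map (CommRingCat.ofHom (algebraMap K (grading 2 K 0))) = F.hom := Over.w i
  obtain ⟨j, φ, v, hf', hj, -, hφ⟩ := exists_chart_of_point (f ≫ i') (by
    rw [Category.assoc, hw, hf])
  refine ⟨q, v, hq, hq0, ⟨j, hj⟩, ?_, ?_⟩
  · rw [← hφ 2 q hq (by simpa using hq)]
    let U : (Proj (grading 2 K)).Opens := Proj.basicOpen (grading 2 K) (MvPolynomial.X j)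
    let a := HomogeneousLocalization.Away.mk (grading 2 K) (X_mem_grading 2 K j) 2 q
      (by simpa using hq)
    have h1 : i'.app U (Proj.awayToSection (grading 2 K) (MvPolynomial.X j) a) = 0 := by
      have : dehomogenize hq j ∈ i'.ker.ideal (chart 2 K j) := by
        refine (hker j).ge ?_
        exact Ideal.mem_span_singleton_self _
      rwa [Scheme.Hom.ker_apply] at this
    have hle : (⊤ : (Spec (.of L)).Opens) ≤ (f ≫ i') ⁻¹ᵁ U := by
      intro z _
      rw [← hf']
      exact chart_preimage_chartι j (x := Spec.map (CommRingCat.ofHom φ) z) trivial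
    have h2 : (f ≫ i').appLE U ⊤ hle
        (Proj.awayToSection (grading 2 K) (MvPolynomial.X j) a) = 0 := by
      rw [Scheme.Hom.comp_appLE, CommRingCat.comp_apply, h1, map_zero]
    have h3 : (f ≫ i').appLE U ⊤ hle = (chartι 2 K j).appLE U ⊤ (chart_preimage_chartι j) ≫
        (Spec.map (CommRingCat.ofHom φ)).appTop := by
      have h : (Spec.map (CommRingCat.ofHom φ)).appTop =
          (Spec.map (CommRingCat.ofHom φ)).appLE ⊤ ⊤ le_top := by
        rw [Scheme.Hom.appTop, Scheme.Hom.app_eq_appLE]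
        rfl
      rw [h]
      refine Eq.trans ?_ (Scheme.Hom.appLE_comp_appLE _ _ _ _ _ _ _).symm
      simp only [hf']
    have h4 : (Proj.awayToSection (grading 2 K) (MvPolynomial.X j) ≫
        (f ≫ i').appLE U ⊤ hle) = CommRingCat.ofHom φ ≫ (Scheme.ΓSpecIso (.of L)).inv := by
      rw [h3, ← Category.assoc, awayToSection_appLE, Scheme.ΓSpecIso_inv_naturality]
    have h5 : (Scheme.ΓSpecIso (.of L)).inv (φ a) = 0 :=
      (congrArg (fun m ↦ m a) h4).symm.trans h2
    have h6 := congrArg (Scheme.ΓSpecIso (.of L)).hom h5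
    rwa [map_zero, ← CommRingCat.comp_apply, Iso.inv_hom_id, CommRingCat.id_apply] at h6
  · obtain ⟨p, hp⟩ := exists_point_of_coord_mem (IntermediateField.adjoin K (Set.range v))
      (fun i ↦ IntermediateField.subset_adjoin _ _ ⟨i, rfl⟩) hφ
    rw [hf'] at hp
    have hsurj : Surjective (Limits.pullback.snd i' p) := by
      refine ⟨fun z ↦ ?_⟩
      let c := Limits.pullback.lift f (Spec.map (CommRingCat.ofHom
        (algebraMap (IntermediateField.adjoin K (Set.range v)) L))) hp.symm
      exact ⟨c (IsLocalRing.closedPoint L), Subsingleton.elim (α := PrimeSpectrum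
        (IntermediateField.adjoin K (Set.range v))) _ _⟩
    have hiso : IsIso (Limits.pullback.snd i' p) := isIso_of_isClosedImmersion_of_surjective _
    refine hgen _ (inv (Limits.pullback.snd i' p) ≫ Limits.pullback.fst i' p) ?_
    rw [← cancel_mono i', ← hp, Category.assoc, Category.assoc, Limits.pullback.condition,
      IsIso.inv_hom_id_assoc]

end Conic

/-! ### The action on the function field -/

section Action

universe w

variable {k : Type w} [Field k] (X : Over (Spec (.of k))) [IsIntegral X.left] {ξ : X.left}

/-- Automorphisms of an integral scheme over a field act on its function field, which is the
residue field of the generic point. To obtain a left action, `g` acts by pullback along `g⁻¹`. -/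
lemma exists_action_residueField (hξ : ξ = genericPoint X.left) [Algebra k (X.left.residueField ξ)]
    (hk : X.left.fromSpecResidueField ξ ≫ X.hom =
      Spec.map (CommRingCat.ofHom (algebraMap k (X.left.residueField ξ)))) :
    ∃ ρ : Aut X →* (X.left.residueField ξ ≃ₐ[k] X.left.residueField ξ),
      ∀ g : Aut X, Spec.map (CommRingCat.ofHom
          (ρ g : X.left.residueField ξ →+* X.left.residueField ξ)) ≫
        X.left.fromSpecResidueField ξ = X.left.fromSpecResidueField ξ ≫ g.inv.left := by
  have hex : ∀ g : Aut X, ∃ φ : X.left.residueField ξ ⟶ X.left.residueField ξ,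
      Spec.map φ ≫ X.left.fromSpecResidueField ξ =
        X.left.fromSpecResidueField ξ ≫ g.inv.left := by
    intro g
    refine exists_SpecMap_fromSpecResidueField (M := X.left.residueField ξ) _ ?_
    have hiso : IsIso g.inv.left := ((Over.forget _).mapIso (g : X ≅ X)).isIso_inv
    have h := genericPoint_eq_of_isOpenImmersion g.inv.left
    rw [← hξ] at h
    refine Eq.trans ?_ h
    exact congrArg g.inv.left (Scheme.fromSpecResidueField_apply ξ _)
  choose φ hφ using hex
  have hφk : ∀ g c, φ g (algebraMap k _ c) = algebraMap k _ c := by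
    intro g
    have h : CommRingCat.ofHom (algebraMap k (X.left.residueField ξ)) ≫ φ g =
        CommRingCat.ofHom (algebraMap k (X.left.residueField ξ)) := by
      apply Spec.map_injective
      rw [Spec.map_comp, ← hk, ← Category.assoc, hφ, Category.assoc, Over.w]
    exact fun c ↦ congrArg (fun m ↦ m c) h
  have hone : φ 1 = 𝟙 _ := by
    apply eq_of_SpecMap_fromSpecResidueField
    rw [hφ, Spec.map_id, Category.id_comp]
    exact Category.comp_id _
  have hmul : ∀ g h, φ (g * h) = φ h ≫ φ g := by
    intro g h
    apply eq_of_SpecMap_fromSpecResidueField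
    rw [hφ, Spec.map_comp, Category.assoc, hφ, ← Category.assoc, hφ, Category.assoc]
    rfl
  let ρ : Aut X →* (X.left.residueField ξ →ₐ[k] X.left.residueField ξ) :=
    { toFun g := { (φ g).hom with commutes' := hφk g }
      map_one' := AlgHom.ext fun z ↦ congrArg (fun m ↦ m z) hone
      map_mul' g h := AlgHom.ext fun z ↦ congrArg (fun m ↦ m z) (hmul g h) }
  exact ⟨(AlgEquiv.algHomUnitsEquiv k _).toMonoidHom.comp ρ.toHomUnits, hφ⟩

/-- An automorphism that acts trivially on the function field is trivial. -/
lemma eq_one_of_fromSpecResidueField_comp [IsSeparated X.hom] (hξ : ξ = genericPoint X.left)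
    (g : Aut X)
    (h : X.left.fromSpecResidueField ξ ≫ g.inv.left = X.left.fromSpecResidueField ξ) : g = 1 := by
  have hdom : IsDominant (X.left.fromSpecResidueField ξ) := by
    refine ⟨?_⟩
    rw [DenseRange, Scheme.range_fromSpecResidueField, hξ]
    exact dense_iff_closure_eq.2 (genericPoint_closure _)
  have h1 : g.inv.left = 𝟙 X.left := by
    refine ext_of_isDominant_of_isSeparated X.hom ?_
      (X.left.fromSpecResidueField ξ) ?_
    · rw [Over.w, Category.id_comp]
    · rw [h, Category.comp_id]
  have h2 : g.inv = 𝟙 X := by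
    ext1
    exact h1
  rw [← inv_eq_one]
  ext1
  exact h2

/-- The action of an automorphism that preserves a morphism `π` on the residue field of the image
of the generic point. -/
lemma exists_algebraMap_eq_of_comp {X B : Scheme.{w}} {M : Type w} [Field M]
    (f : Spec (.of M) ⟶ X) (π : X ⟶ B) (g : X ⟶ X) (β : B ⟶ B) (hβ : g ≫ π = π ≫ β)
    (ψ : M →+* M) (hψ : Spec.map (CommRingCat.ofHom ψ) ≫ f = f ≫ g) {b : B}
    (i : B.residueField b ⟶ .of M) (hi : Spec.map i ≫ B.fromSpecResidueField b = f ≫ π)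
    (z : B.residueField b) : ∃ w, ψ (i z) = i w := by
  have hb : (f ≫ π) (IsLocalRing.closedPoint M) = b := by
    rw [← hi]
    exact Scheme.fromSpecResidueField_apply b _
  have hcomm : f ≫ π ≫ β = Spec.map (CommRingCat.ofHom ψ) ≫ f ≫ π := by
    rw [← hβ, ← Category.assoc, ← hψ, Category.assoc]
  have hβb : β b = b := by
    have h1 : (f ≫ π ≫ β) (IsLocalRing.closedPoint M) = b := by
      rw [hcomm, ← hb]
      exact congrArg (f ≫ π) (Subsingleton.elim (α := PrimeSpectrum M) _ _)
    refine Eq.trans (congrArg β hb.symm) ?_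
    exact h1
  obtain ⟨γ, hγ⟩ := exists_SpecMap_fromSpecResidueField (M := B.residueField b)
    (B.fromSpecResidueField b ≫ β) (x := b) (by
      refine Eq.trans (congrArg β (Scheme.fromSpecResidueField_apply b _)) hβb)
  have h2 : i ≫ CommRingCat.ofHom ψ = γ ≫ i := by
    apply eq_of_SpecMap_fromSpecResidueField
    rw [Spec.map_comp, Spec.map_comp, Category.assoc, Category.assoc, hγ, hi, ← hcomm,
      ← Category.assoc, ← hi, Category.assoc]
  exact ⟨γ z, congrArg (fun m ↦ m z) h2⟩

end Action

/-! ### Rational schemes -/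

section Rational

universe w

/-- The function field of a scheme that is rational over a field `k` embeds in a field of rational
functions over `k`. -/
lemma exists_algHom_fractionRing {k : Type w} [Field k] (X : Over (Spec (.of k)))
    [IsIntegral X.left] [Scheme.IsRationalOver X.hom]
    {ξ : X.left} (hξ : ξ = genericPoint X.left) [Algebra k (X.left.residueField ξ)]
    (hk : X.left.fromSpecResidueField ξ ≫ X.hom =
      Spec.map (CommRingCat.ofHom (algebraMap k (X.left.residueField ξ)))) :
    ∃ n : Type w, Nonempty (X.left.residueField ξ →ₐ[k] FractionRing (MvPolynomial n k)) := by
  obtain ⟨n, F, hF⟩ := Scheme.IsRationalOver.exists_birationalOver_affineSpace (sX := X.hom)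
  refine ⟨n, ?_⟩
  let Y := 𝔸(n; Spec (.of k))
  let A := FractionRing (MvPolynomial n k)
  let e := AffineSpace.SpecIso n (.of k)
  have hYne : Nonempty Y := ⟨e.inv (IsLocalRing.closedPoint A |> PrimeSpectrum.comap
    (algebraMap (MvPolynomial n k) A))⟩
  have hY : IsIntegral Y := isIntegral_of_isOpenImmersion e.hom
  let c : Spec (.of A) ⟶ Y := Spec.map (CommRingCat.ofHom (algebraMap (MvPolynomial n k) A)) ≫ e.inv
  have hc : c (IsLocalRing.closedPoint A) = genericPoint Y := by
    refine Eq.trans ?_ (genericPoint_eq_of_isOpenImmersion e.inv)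
    refine congrArg e.inv ?_
    refine Eq.trans ?_ (genericPoint_eq_bot_of_affine (.of (MvPolynomial n k))).symm
    refine PrimeSpectrum.ext ?_
    change (IsLocalRing.maximalIdeal A).comap (algebraMap (MvPolynomial n k) A) = ⊥
    rw [IsLocalRing.maximalIdeal_eq_bot, ← RingHom.ker_eq_comap_bot]
    exact (RingHom.injective_iff_ker_eq_bot _).1 (IsFractionRing.injective (MvPolynomial n k) A)
  have hgen : genericPoint Y ∈ F.target := by
    rw [← SetLike.mem_coe, (genericPoint_spec Y).mem_open_set_iff F.target.isOpen, Set.univ_inter]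
    exact F.dense_target.nonempty
  have hrange : Set.range c ⊆ Set.range F.target.ι := by
    rintro _ ⟨z, rfl⟩
    rw [Subsingleton.elim (α := PrimeSpectrum A) z (IsLocalRing.closedPoint A), hc]
    simpa using hgen
  let c' := IsOpenImmersion.lift F.target.ι c hrange
  have hc' : c' ≫ F.target.ι = c := IsOpenImmersion.lift_fac _ _ _
  have hne : Nonempty F.target := ⟨⟨_, hgen⟩⟩
  have hne' : Nonempty F.source := ⟨F.iso.inv hne.some⟩
  have hpt : c' (IsLocalRing.closedPoint A) = genericPoint F.target := by
    apply F.target.ι.injective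
    refine Eq.trans ?_ (genericPoint_eq_of_isOpenImmersion F.target.ι).symm
    rw [← hc, ← hc']
    rfl
  let f : Spec (.of A) ⟶ X.left := c' ≫ F.iso.inv ≫ F.source.ι
  have hf : f (IsLocalRing.closedPoint A) = ξ := by
    rw [hξ]
    refine Eq.trans ?_ (genericPoint_eq_of_isOpenImmersion (F.iso.inv ≫ F.source.ι))
    exact congrArg (F.iso.inv ≫ F.source.ι) hpt
  obtain ⟨φ, hφ⟩ := exists_SpecMap_fromSpecResidueField f hf
  have hfk : f ≫ X.hom = Spec.map (CommRingCat.ofHom (algebraMap k A)) := by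
    have h1 : F.iso.inv ≫ F.source.ι ≫ X.hom = F.target.ι ≫ Y ↘ Spec (.of k) := by
      rw [Iso.inv_comp_eq]
      exact Eq.symm hF
    simp only [f, Category.assoc]
    rw [h1, ← Category.assoc, hc']
    simp only [c, Category.assoc]
    rw [AffineSpace.SpecIso_inv_over, ← Spec.map_comp]
    rfl
  have h2 : CommRingCat.ofHom (algebraMap k (X.left.residueField ξ)) ≫ φ =
      CommRingCat.ofHom (algebraMap k A) := by
    apply Spec.map_injective
    rw [Spec.map_comp, ← hk, ← Category.assoc, hφ, hfk]
  exact ⟨{ φ.hom with commutes' := fun z ↦ congrArg (fun m ↦ m z) h2 }⟩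

end Rational

/-! ### The theorem on conic bundles -/

section Main

/-- The function field of a plane conic over an abstract field `K = ℝ(t)`. -/
lemma exists_normal_abelian_of_algebra {n : Type v} {K L G : Type*} [Field K] [Field L]
    [Algebra ℝ K] [Algebra ℝ L] [Algebra K L] [IsScalarTower ℝ K L] [Group G] [Finite G]
    (ρ : G →* (L ≃ₐ[ℝ] L)) (hρ : Function.Injective ρ)
    (hK : ∀ g (z : K), ∃ w : K, ρ g (algebraMap K L z) = algebraMap K L w)
    (ht : ∃ t : K, IntermediateField.adjoin ℝ {t} = ⊤)
    (φ : L →ₐ[ℝ] FractionRing (MvPolynomial n ℝ))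
    (q : MvPolynomial (Fin 3) K)
    (hq : q ∈ MvPolynomial.homogeneousSubmodule (Fin 3) K 2) (hq0 : q ≠ 0) (v : Fin 3 → L)
    (hv : ∃ i, v i = 1) (hvq : MvPolynomial.aeval v q = 0)
    (htop : IntermediateField.adjoin K (Set.range v) = ⊤) :
    ∃ A : Subgroup G, A.Normal ∧ IsMulCommutative A ∧ A.index ≤ 8 := by
  obtain ⟨t, ht⟩ := ht
  let i := IsScalarTower.toAlgHom ℝ K L
  let e : K →+* i.fieldRange := (i : K →+* L).codRestrict i.fieldRange fun z ↦ ⟨z, rfl⟩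
  refine exists_normal_abelian_of_conic ρ hρ i.fieldRange ?_ (algebraMap K L t) ?_ φ
    (MvPolynomial.map e q) (MvPolynomial.IsHomogeneous.map hq e) ?_ v hv ?_ ?_
  · rintro g _ ⟨z, rfl⟩
    obtain ⟨w, hw⟩ := hK g z
    exact ⟨w, hw.symm⟩
  · have h := IntermediateField.adjoin_map (F := ℝ) {t} i
    rw [ht, Set.image_singleton, ← AlgHom.fieldRange_eq_map] at h
    exact h
  · rwa [Ne, map_eq_zero_iff _ (MvPolynomial.map_injective e e.injective)]
  · rw [MvPolynomial.aeval_def, MvPolynomial.eval₂_map]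
    exact hvq
  · rw [eq_top_iff]
    intro z _
    refine mem_of_adjoin_eq_top htop
      (IntermediateField.adjoin i.fieldRange (Set.range v)).toSubfield (fun k ↦ ?_)
      (fun z hz ↦ IntermediateField.subset_adjoin _ _ hz) z
    exact (IntermediateField.adjoin i.fieldRange (Set.range v)).algebraMap_mem
      (⟨algebraMap K L k, k, rfl⟩ : i.fieldRange)

/-- The residue field of a point of a conic bundle is generated over that of its image in the base
by the homogeneous coordinates of a zero of a quadratic form. -/
lemma IsConicBundle.exists_coord {X B : Scheme.{v}} {π : X ⟶ B} (hπ : IsConicBundle π) {x : X}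
    {b : B} [Algebra (B.residueField b) (X.residueField x)]
    (h : Spec.map (CommRingCat.ofHom (algebraMap (B.residueField b) (X.residueField x))) ≫
      B.fromSpecResidueField b = X.fromSpecResidueField x ≫ π) :
    ∃ (q : MvPolynomial (Fin 3) (B.residueField b)) (v : Fin 3 → X.residueField x),
      q ∈ MvPolynomial.homogeneousSubmodule (Fin 3) (B.residueField b) 2 ∧ q ≠ 0 ∧
        (∃ i, v i = 1) ∧ MvPolynomial.aeval v q = 0 ∧
          IntermediateField.adjoin (B.residueField b) (Set.range v) = ⊤ := by
  let f : Spec (X.residueField x) ⟶ π.fiber b :=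
    Limits.pullback.lift (X.fromSpecResidueField x) _ h.symm
  have hf : f ≫ π.fiberι b = X.fromSpecResidueField x := Limits.pullback.lift_fst _ _ _
  refine (hπ b).exists_coord f (Limits.pullback.lift_snd _ _ _) fun S g hg ↦ ?_
  have h1 := surjective_of_SpecMap_comp_eq (X := X) (x := x) (M := S)
    (CommRingCat.ofHom (algebraMap S (X.residueField x))) (g ≫ π.fiberι b) (by rw [← hf, ← hg]; rfl)
  rw [eq_top_iff]
  intro z _
  obtain ⟨s, rfl⟩ := h1 z
  exact s.2

/-- A finite group of automorphisms of a real rational surface, or more generally of an integral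
separated scheme that is rational over `ℝ`, that preserve a conic bundle structure over the
projective line has a normal abelian subgroup of index at most `8`. -/
theorem exists_normal_abelian_of_isConicBundle (X : Over (Spec (.of ℝ)))
    [IsIntegral X.left] [IsSeparated X.hom] [Scheme.IsRationalOver X.hom]
    (π : X ⟶ projectiveSpace 1 ℝ) (hπ : IsConicBundle π.left)
    (G : Subgroup (autOver π)) [Finite G] :
    ∃ A : Subgroup G, A.Normal ∧ IsMulCommutative A ∧ A.index ≤ 8 := by
  obtain ⟨ξ, hξ⟩ : ∃ ξ, ξ = genericPoint X.left := ⟨_, rfl⟩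
  let L := X.left.residueField ξ
  let f : Spec L ⟶ X.left := X.left.fromSpecResidueField ξ
  let π' : X.left ⟶ Proj (grading 1 ℝ) := π.left
  obtain ⟨η, hη⟩ : ∃ η, (f ≫ π') (IsLocalRing.closedPoint L) = η := ⟨_, rfl⟩
  let K := (Proj (grading 1 ℝ)).residueField η
  obtain ⟨i, hi⟩ := exists_SpecMap_fromSpecResidueField (M := L) (f ≫ π') hη
  let sP : Proj (grading 1 ℝ) ⟶ Spec (.of ℝ) := (projectiveSpace 1 ℝ).hom
  let sK : .of ℝ ⟶ K := Spec.preimage ((Proj (grading 1 ℝ)).fromSpecResidueField η ≫ sP)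
  let sL : .of ℝ ⟶ L := Spec.preimage (f ≫ X.hom)
  let : Algebra ℝ K := sK.hom.toAlgebra
  let : Algebra ℝ L := sL.hom.toAlgebra
  let : Algebra K L := i.hom.toAlgebra
  have hsK : (Proj (grading 1 ℝ)).fromSpecResidueField η ≫ sP =
    Spec.map (CommRingCat.ofHom (algebraMap ℝ K)) := (Spec.map_preimage _).symm
  have hsL : f ≫ X.hom = Spec.map (CommRingCat.ofHom (algebraMap ℝ L)) := (Spec.map_preimage _).symm
  have htower : sL = sK ≫ i := by
    apply Spec.map_injective
    rw [Spec.map_comp, Spec.map_preimage, Spec.map_preimage, ← Category.assoc, hi, Category.assoc]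
    exact congrArg (f ≫ ·) (Over.w π).symm
  have : IsScalarTower ℝ K L := .of_algebraMap_eq fun r ↦ congrArg (fun m ↦ m r) htower
  obtain ⟨ρ, hρ⟩ := exists_action_residueField X hξ hsL
  obtain ⟨n, ⟨φ⟩⟩ := exists_algHom_fractionRing X hξ hsL
  have ht := exists_adjoin_simple_eq_top_residueField η hsK
  have hinj : Function.Injective ρ := by
    rw [injective_iff_map_eq_one]
    intro g hg
    refine eq_one_of_fromSpecResidueField_comp X hξ g ?_
    rw [← hρ, hg]
    exact (congrArg (· ≫ X.left.fromSpecResidueField ξ) (Spec.map_id _)).trans (Category.id_comp _)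
  have hπ' : IsConicBundle π' := hπ
  obtain ⟨q, v, hq, hq0, hv, hvq, htop⟩ := hπ'.exists_coord (x := ξ) (b := η) hi
  refine exists_normal_abelian_of_algebra (K := K) (L := L)
    (ρ.comp ((autOver π).subtype.comp G.subtype))
    (hinj.comp ((autOver π).subtype_injective.comp G.subtype_injective)) (fun g z ↦ ?_) ht φ
    q hq hq0 v hv hvq htop
  obtain ⟨β, hβ⟩ := (g : autOver π)⁻¹.2
  exact exists_algebraMap_eq_of_comp f π' (g : Aut X).inv.left β.hom.left
    (congrArg (fun m ↦ m.left) hβ) _ (hρ _) i hi z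

end Main

end ConicBundles

theorem mainTheorem9 (X : Over (Spec (.of ℝ)))
    [IsIntegral X.left] [IsProper X.hom] [SmoothOfRelativeDimension 2 X.hom]
    [Scheme.IsRationalOver X.hom]
    (π : X ⟶ ConicBundles.projectiveSpace 1 ℝ) (hπ : ConicBundles.IsConicBundle π.left) :
    ConicBundles.jordanConstant (ConicBundles.autOver π) ≤ 32 ∧
      ConicBundles.weakJordanConstant (ConicBundles.autOver π) ≤ 8 := by
  have h : ∀ G : Subgroup (ConicBundles.autOver π), Finite G →
      ∃ A : Subgroup G, A.Normal ∧ IsMulCommutative A ∧ A.index ≤ 8 :=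
    fun G _ ↦ ConicBundles.exists_normal_abelian_of_isConicBundle X π hπ G
  constructor
  · refine (iInf₂_le 8 ⟨by norm_num, h⟩).trans ?_
    norm_num
  · refine iInf₂_le 8 ⟨by norm_num, fun G hG ↦ ?_⟩
    obtain ⟨A, -, hA⟩ := h G hG
    exact ⟨A, hA⟩
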